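/- Let $K$ be a commutative locally compact hypergroup (in the sense of Dunkl, Jewett and Spector) with convolution $\omega(x,y)=\delta_x*\delta_y$, involution $x\mapsto\tilde x$ and Haar measure $\mu$. Translations are $T_xf(y)=\int_K f\,d\omega(x,y)$, and $UC(K)$ is the space of all $f\in C^b(K)$ for which $x\mapsto T_xf$ is continuous from $K$ to $(C^b(K),\|\cdot\|_\infty)$. Let $\widehat K$ be the set of nonzero $\alpha\in C^b(K)$ with $\int_K\alpha\,d\omega(x,y)=\alpha(x)\alpha(y)$ and $\alpha(\tilde x)=\overline{\alpha(x)}$ for all $x,y\in K$. For $\alpha\in\widehat K$ and $X=UC(K)$ or $X=L^\infty(K)$, an $\alpha$-mean on $X$ is a bounded linear functional $m$ on $X$ with $m(\alpha)=1$ and $m(T_xf)=\alpha(x)m(f)$ for all $f\in X$, $x\in K$. The space $X$ is called $\alpha$-amenable if it has an $\alpha$-mean, and $K$ is called $\alpha$-amenable if $L^\infty(K)$ is. Theorem. Let $\alpha\in\widehat K$. Then $UC(K)$ is $\alpha$-amenable if and only if $K$ is $\alpha$-amenable. Moreover, there are $g\in L^1(K)$ with $\widehat g(\alpha)=\int_K\overline{\alpha}\,g\,d\mu=1$,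 and for every $\alpha$-mean $m$ on $UC(K)$ and every such $g$ the following holds: $\varphi*g\in UC(K)$ for all $\varphi\in L^\infty(K)$, where $(\varphi*g)(x)=\int_K\varphi(y)\,T_{\tilde y}g(x)\,d\mu(y)$, and $\varphi\mapsto m(\varphi*g)$ is an $\alpha$-mean on $L^\infty(K)$ whose restriction to $UC(K)$ is $m$. -/

import Mathlib

open MeasureTheory Topology
open scoped ENNReal NNReal BoundedContinuousFunction ComplexConjugate

/-- A (locally compact) hypergroup in the sense of Dunkl, Jewett and Spector. The underlying space is
supposed to be locally compact and Hausdorff wherever the notion is used. `conv x y` is the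
convolution `ω(x, y) = δ_x * δ_y` of the point masses at `x` and `y`; the topology on
`ProbabilityMeasure K` is the weak topology and the topology on the compact subsets of `K` is the
Michael (Vietoris) topology. -/
class Hypergroup (K : Type*) [TopologicalSpace K] [MeasurableSpace K] [BorelSpace K] where
  conv : K → K → ProbabilityMeasure K
  one : K
  invol : K → K
  regular_conv : ∀ x y, (conv x y : Measure K).Regular
  isCompact_support : ∀ x y, IsCompact (conv x y : Measure K).support
  continuous_conv : Continuous fun p : K × K => conv p.1 p.2
  continuous_support :
    Continuous[inferInstance, TopologicalSpace.vietoris K]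
      fun p : K × K => (conv p.1 p.2 : Measure K).support
  one_conv : ∀ x, (conv one x : Measure K) = Measure.dirac x
  conv_one : ∀ x, (conv x one : Measure K) = Measure.dirac x
  /-- `δ_x * (δ_y * δ_z) = (δ_x * δ_y) * δ_z`, tested against bounded continuous functions. -/
  conv_assoc : ∀ (x y z : K) (f : K →ᵇ ℂ),
    ∫ t, (∫ s, f s ∂(conv x t : Measure K)) ∂(conv y z : Measure K) =
      ∫ t, (∫ s, f s ∂(conv t z : Measure K)) ∂(conv x y : Measure K)
  continuous_invol : Continuous invol
  invol_invol : ∀ x, invol (invol x) = x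
  map_invol_conv : ∀ x y,
    (conv x y : Measure K).map invol = (conv (invol y) (invol x) : Measure K)
  one_mem_support_iff : ∀ x y, one ∈ (conv x y : Measure K).support ↔ y = invol x

/-- A commutative hypergroup: `ω(x, y) = ω(y, x)`. -/
class CommHypergroup (K : Type*) [TopologicalSpace K] [MeasurableSpace K] [BorelSpace K]
    extends Hypergroup K where
  conv_comm : ∀ x y : K, conv x y = conv y x

namespace Hypergroup

noncomputable section

variable {K : Type*} [TopologicalSpace K] [MeasurableSpace K] [BorelSpace K]

/-- A Haar measure on `K`: a nonzero positive Radon measure that satisfies `∫ T_x f dμ = ∫ f dμ` for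
all nonnegative `f ∈ C_c(K)` and all `x ∈ K`. Radon measures are normalized to be inner regular on
all Borel sets, so that "null" and "locally null" agree for Borel sets also if `K` is not
`σ`-compact, and `L^∞(μ)` is the usual space of (locally) essentially bounded functions. -/
class IsHaar [Hypergroup K] (μ : Measure K) : Prop
    extends IsFiniteMeasureOnCompacts μ, μ.InnerRegular where
  ne_zero : μ ≠ 0
  lintegral_translate : ∀ (x : K) (f : K → ℝ≥0), Continuous f → HasCompactSupport f →
    ∫⁻ y, (∫⁻ t, (f t : ℝ≥0∞) ∂(conv x y : Measure K)) ∂μ = ∫⁻ y, (f y : ℝ≥0∞) ∂μ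

section translation

variable [Hypergroup K]

lemma integrable_conv (f : K →ᵇ ℂ) (x y : K) : Integrable f (conv x y : Measure K) :=
  f.integrable _

/-- The translation `T_x f (y) = ∫ f dω(x, y)` on `C^b(K)`. -/
def translate (x : K) (f : K →ᵇ ℂ) : K →ᵇ ℂ :=
  BoundedContinuousFunction.ofNormedAddCommGroup (fun y => ∫ t, f t ∂(conv x y : Measure K))
    (continuous_iff_continuousAt.2 fun y =>
      (ProbabilityMeasure.tendsto_iff_forall_integral_rclike_tendsto ℂ).1
        ((continuous_conv.comp (Continuous.prodMk_right x)).tendsto y) f)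
    ‖f‖ (fun _ => f.norm_integral_le_norm _)

lemma translate_apply (x : K) (f : K →ᵇ ℂ) (y : K) :
    translate x f y = ∫ t, f t ∂(conv x y : Measure K) := rfl

lemma translate_add (x : K) (f g : K →ᵇ ℂ) :
    translate x (f + g) = translate x f + translate x g := by
  ext y
  simpa [translate_apply] using integral_add (integrable_conv f x y) (integrable_conv g x y)

lemma translate_smul (x : K) (c : ℂ) (f : K →ᵇ ℂ) :
    translate x (c • f) = c • translate x f := by
  ext y
  simp [translate_apply, integral_const_mul]

lemma norm_translate_le (x : K) (f : K →ᵇ ℂ) : ‖translate x f‖ ≤ ‖f‖ :=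
  BoundedContinuousFunction.norm_ofNormedAddCommGroup_le _ (norm_nonneg f) _

variable (K) in
/-- `UC(K)`: the bounded continuous functions `f` for which `x ↦ T_x f` is continuous from `K` to
`C^b(K)` with the uniform norm. -/
def UC : Submodule ℂ (K →ᵇ ℂ) where
  carrier := {f | Continuous fun x => translate x f}
  zero_mem' := by
    have h : (fun x : K => translate x (0 : K →ᵇ ℂ)) = fun _ => 0 := by
      ext x y
      simp [translate_apply]
    simpa [h] using (continuous_const : Continuous fun _ : K => (0 : K →ᵇ ℂ))
  add_mem' := by
    intro f g hf hg
    change Continuous fun x => translate x (f + g)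
    simp only [translate_add]
    exact Continuous.add (f := fun x => translate x f) (g := fun x => translate x g) hf hg
  smul_mem' := by
    intro c f hf
    change Continuous fun x => translate x (c • f)
    simp only [translate_smul]
    exact Continuous.const_smul (g := fun x => translate x f) hf c

variable (K) in
/-- The dual `K̂`: the nonzero bounded continuous functions with `ω(x, y)(α) = α(x) α(y)` and
`α(x̃) = conj (α(x))`. -/
def Dual : Set (K →ᵇ ℂ) :=
  {α | α ≠ 0 ∧ (∀ x y, ∫ t, α t ∂(conv x y : Measure K) = α x * α y) ∧
    ∀ x, α (invol x) = conj (α x)}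

lemma dual_subset_UC {α : K →ᵇ ℂ} (hα : α ∈ Dual K) : α ∈ UC K := by
  have h : (fun x => translate x α) = fun x => α x • α := by
    ext x y
    simpa [translate_apply] using hα.2.1 x y
  change Continuous fun x => translate x α
  rw [h]
  exact α.continuous.smul continuous_const

end translation

lemma translate_mem_UC [CommHypergroup K] (x : K) {f : K →ᵇ ℂ} (hf : f ∈ UC K) :
    translate x f ∈ UC K := by
  have hcomm : ∀ z, translate z (translate x f) = translate x (translate z f) := by
    intro z
    ext y
    have h1 := conv_assoc x z y f
    have h2 := conv_assoc z x y f
    rw [CommHypergroup.conv_comm z x] at h2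
    exact h1.trans h2.symm
  change Continuous fun z => translate z (translate x f)
  simp only [hcomm]
  have hlip : LipschitzWith 1 (translate x : (K →ᵇ ℂ) → K →ᵇ ℂ) :=
    LipschitzWith.of_dist_le_mul fun g h => by
      have : translate x g - translate x h = translate x (g - h) := by
        have := translate_add x (g - h) h
        rw [sub_add_cancel] at this
        rw [this, add_sub_cancel_right]
      rw [dist_eq_norm, this, dist_eq_norm, NNReal.coe_one, one_mul]
      exact norm_translate_le x _
  exact hlip.continuous.comp hf

/-- The translation on `UC(K)`. -/
def translateUC [CommHypergroup K] (x : K) (f : UC K) : UC K :=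
  ⟨translate x f, translate_mem_UC x f.2⟩

section Linfty

variable [T2Space K] [LocallyCompactSpace K] [Hypergroup K]

/-- The part of `ω(x, y)` inside an open set is seen by functions in `C_c(K)`. -/
lemma exists_compactlySupported (x : K) {U : Set K} (hU : IsOpen U) {c : ℝ≥0∞} {y : K}
    (hc : c < (conv x y : Measure K) U) :
    ∃ f : K → ℝ≥0, Continuous f ∧ HasCompactSupport f ∧ (∀ t, (f t : ℝ≥0∞) ≤ U.indicator 1 t) ∧
      ∀ᶠ z in 𝓝 y, c < ∫⁻ t, (f t : ℝ≥0∞) ∂(conv x z : Measure K) := by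
  have := regular_conv x y
  obtain ⟨C, hCU, hC, hcC⟩ := hU.exists_lt_isCompact hc
  obtain ⟨f, h1, h0, hs, hf⟩ := exists_continuous_one_zero_of_isCompact hC hU.isClosed_compl
    (Set.disjoint_compl_right_iff_subset.2 hCU)
  let g : K → ℝ≥0 := fun t => (f t).toNNReal
  have hg : Continuous g := continuous_real_toNNReal.comp f.continuous
  have hg1 : ∀ t, g t ≤ 1 := fun t => by simpa [g] using (hf t).2
  have hgC : ∀ t ∈ C, g t = 1 := fun t ht => by simp [g, h1 ht]
  refine ⟨g, hg, hs.comp_left (g := Real.toNNReal) (by simp), fun t => ?_, ?_⟩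
  · by_cases ht : t ∈ U
    · simpa [ht] using hg1 t
    · simp [ht, g, h0 (show t ∈ Uᶜ from ht)]
  · let F : K →ᵇ ℝ≥0 := BoundedContinuousFunction.mkOfBound ⟨g, hg⟩ 1 fun s t => by
      have hs := hg1 s
      have ht := hg1 t
      rw [NNReal.dist_eq, abs_le]
      simp only [ContinuousMap.coe_mk]
      constructor <;> linarith [(g s).coe_nonneg, (g t).coe_nonneg, NNReal.coe_le_coe.2 hs,
        NNReal.coe_le_coe.2 ht, NNReal.coe_one]
    have hcont : Filter.Tendsto (fun z => ∫⁻ t, (F t : ℝ≥0∞) ∂(conv x z : Measure K)) (𝓝 y)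
        (𝓝 (∫⁻ t, (F t : ℝ≥0∞) ∂(conv x y : Measure K))) :=
      (ProbabilityMeasure.tendsto_iff_forall_lintegral_tendsto).1
        ((continuous_conv.comp (Continuous.prodMk_right x)).tendsto y) F
    refine hcont.eventually (lt_mem_nhds (hcC.trans_le ?_))
    calc (conv x y : Measure K) C = ∫⁻ t, C.indicator 1 t ∂(conv x y : Measure K) :=
          (lintegral_indicator_one hC.measurableSet).symm
      _ ≤ _ := lintegral_mono fun t => by
          by_cases ht : t ∈ C
          · have : F t = 1 := hgC t ht
            simp [ht, this]
          · simp [ht]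

lemma isOpen_lt_conv (x : K) {U : Set K} (hU : IsOpen U) (c : ℝ≥0∞) :
    IsOpen {y | c < (conv x y : Measure K) U} := by
  refine isOpen_iff_mem_nhds.2 fun y hy => ?_
  obtain ⟨f, hf, hfs, hfU, h⟩ := exists_compactlySupported x hU hy
  filter_upwards [h] with z hz
  refine lt_of_lt_of_le hz ?_
  calc _ ≤ ∫⁻ t, U.indicator 1 t ∂(conv x z : Measure K) := lintegral_mono hfU
    _ = _ := lintegral_indicator_one hU.measurableSet

/-- The kernel `y ↦ ω(x, y)`. -/
def convKernel (x : K) : ProbabilityTheory.Kernel K K where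
  toFun y := conv x y
  measurable' :=
    .measure_of_isPiSystem_of_isProbabilityMeasure (BorelSpace.measurable_eq (α := K))
      isPiSystem_isOpen fun _ hU => measurable_of_Ioi fun c => (isOpen_lt_conv x hU c).measurableSet

instance (x : K) : ProbabilityTheory.IsMarkovKernel (convKernel x) :=
  ⟨fun y => inferInstanceAs (IsProbabilityMeasure (conv x y : Measure K))⟩

lemma mul_measure_lt_conv_le (μ : Measure K) [IsHaar μ] (x : K) {U : Set K} (hU : IsOpen U)
    (c : ℝ≥0∞) : c * μ {y | c < (conv x y : Measure K) U} ≤ μ U := by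
  rw [(isOpen_lt_conv x hU c).measurableSet.measure_eq_iSup_isCompact]
  simp only [ENNReal.mul_iSup]
  refine iSup_le fun D => iSup_le fun hD => iSup_le fun hDc => ?_
  obtain ⟨f, hf, hfs, hfU, h⟩ : ∃ f : K → ℝ≥0, Continuous f ∧ HasCompactSupport f ∧
      (∀ t, (f t : ℝ≥0∞) ≤ U.indicator 1 t) ∧
      ∀ z ∈ D, c < ∫⁻ t, (f t : ℝ≥0∞) ∂(conv x z : Measure K) := by
    refine hDc.induction_on (p := fun D => ∃ f : K → ℝ≥0, Continuous f ∧ HasCompactSupport f ∧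
      (∀ t, (f t : ℝ≥0∞) ≤ U.indicator 1 t) ∧
      ∀ z ∈ D, c < ∫⁻ t, (f t : ℝ≥0∞) ∂(conv x z : Measure K)) ?_ ?_ ?_ ?_
    · exact ⟨0, continuous_zero, HasCompactSupport.zero, by simp, by simp⟩
    · rintro s t hst ⟨f, h1, h2, h3, h4⟩
      exact ⟨f, h1, h2, h3, fun z hz => h4 z (hst hz)⟩
    · rintro s t ⟨f, h1, h2, h3, h4⟩ ⟨g, k1, k2, k3, k4⟩
      refine ⟨f ⊔ g, h1.sup k1, ?_, fun t => ?_, ?_⟩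
      · refine (h2.union k2).of_isClosed_subset (isClosed_tsupport _) ?_
        refine closure_minimal (fun t ht => ?_) ((isClosed_tsupport _).union (isClosed_tsupport _))
        by_contra hn
        simp only [Set.mem_union, not_or] at hn
        exact ht (by simp [image_eq_zero_of_notMem_tsupport hn.1,
          image_eq_zero_of_notMem_tsupport hn.2])
      · rcases le_total (f t) (g t) with hfg | hfg
        · simpa [hfg] using k3 t
        · simpa [hfg] using h3 t
      · rintro z (hz | hz)
        · exact (h4 z hz).trans_le (lintegral_mono fun t => by
            exact ENNReal.coe_le_coe.2 (le_sup_left : f t ≤ f t ⊔ g t))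
        · exact (k4 z hz).trans_le (lintegral_mono fun t => by
            exact ENNReal.coe_le_coe.2 (le_sup_right : g t ≤ f t ⊔ g t))
    · intro y hy
      obtain ⟨f, h1, h2, h3, h4⟩ := exists_compactlySupported x hU (hD hy)
      exact ⟨_, mem_nhdsWithin_of_mem_nhds h4, f, h1, h2, h3, fun z hz => hz⟩
  calc c * μ D = ∫⁻ _ in D, c ∂μ := by simp
    _ ≤ ∫⁻ z in D, (∫⁻ t, (f t : ℝ≥0∞) ∂(conv x z : Measure K)) ∂μ :=
        setLIntegral_mono' hDc.measurableSet fun z hz => (h z hz).le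
    _ ≤ ∫⁻ z, (∫⁻ t, (f t : ℝ≥0∞) ∂(conv x z : Measure K)) ∂μ := setLIntegral_le_lintegral _ _
    _ = ∫⁻ t, (f t : ℝ≥0∞) ∂μ := IsHaar.lintegral_translate x f hf hfs
    _ ≤ ∫⁻ t, U.indicator 1 t ∂μ := lintegral_mono hfU
    _ = μ U := lintegral_indicator_one hU.measurableSet

/-- Supports of `ω(x, y)`, with `y` in a compact set, stay in a relatively compact open set. -/
lemma exists_isOpen_support_subset (x : K) {C : Set K} (hC : IsCompact C) :
    ∃ W : Set K, IsOpen W ∧ IsCompact (closure W) ∧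
      ∀ y ∈ C, (conv x y : Measure K).support ⊆ W := by
  refine hC.induction_on (p := fun C => ∃ W : Set K, IsOpen W ∧ IsCompact (closure W) ∧
      ∀ y ∈ C, (conv x y : Measure K).support ⊆ W) ?_ ?_ ?_ ?_
  · exact ⟨∅, isOpen_empty, by simp, by simp⟩
  · rintro s t hst ⟨W, h1, h2, h3⟩
    exact ⟨W, h1, h2, fun y hy => h3 y (hst hy)⟩
  · rintro s t ⟨W, h1, h2, h3⟩ ⟨V, k1, k2, k3⟩
    refine ⟨W ∪ V, h1.union k1, by rw [closure_union]; exact h2.union k2, ?_⟩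
    rintro y (hy | hy)
    · exact (h3 y hy).trans Set.subset_union_left
    · exact (k3 y hy).trans Set.subset_union_right
  · intro y _
    obtain ⟨W, hW, hsub, hWc⟩ :=
      exists_isOpen_superset_and_isCompact_closure (isCompact_support x y)
    have hopen : IsOpen {p : K × K | (conv p.1 p.2 : Measure K).support ⊆ W} :=
      @IsOpen.preimage _ _ _ (TopologicalSpace.vietoris K) _ continuous_support _
        hW.powerset_vietoris
    have hmem : {z | (conv x z : Measure K).support ⊆ W} ∈ 𝓝 y :=
      (hopen.preimage (Continuous.prodMk_right x)).mem_nhds hsub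
    exact ⟨_, mem_nhdsWithin_of_mem_nhds hmem, W, hW, hWc, fun z hz => hz⟩

/-- Translations respect `μ`-null sets. -/
lemma ae_conv_eq_zero (μ : Measure K) [IsHaar μ] (x : K) {N : Set K} (hN : MeasurableSet N)
    (h0 : μ N = 0) : ∀ᵐ y ∂μ, (conv x y : Measure K) N = 0 := by
  have hmeas : Measurable fun y => (conv x y : Measure K) N :=
    (convKernel x).measurable_coe hN
  have hc : ∀ c : ℝ≥0∞, c ≠ 0 → c ≠ ∞ → μ {y | c < (conv x y : Measure K) N} = 0 := by
    intro c hc0 hct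
    rw [(measurableSet_lt measurable_const hmeas).measure_eq_iSup_isCompact]
    simp only [ENNReal.iSup_eq_zero]
    intro C hCN hC
    obtain ⟨W, hW, hWc, hsub⟩ := exists_isOpen_support_subset x hC
    have hWfin : μ W ≠ ∞ := ((measure_mono subset_closure).trans_lt hWc.measure_lt_top).ne
    have : IsFiniteMeasure (μ.restrict W) := ⟨by simpa using hWfin.lt_top⟩
    have hle : ∀ ε : ℝ≥0∞, ε ≠ 0 → c * μ C ≤ ε := by
      intro ε hε
      have hr : μ.restrict W N = 0 := Measure.restrict_apply_eq_zero' hW.measurableSet |>.2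
        (measure_mono_null Set.inter_subset_left h0)
      obtain ⟨V, hNV, hV, hVε⟩ := N.exists_isOpen_lt_of_lt (μ := μ.restrict W) ε
        (by rw [hr]; exact pos_iff_ne_zero.2 hε)
      rw [Measure.restrict_apply hV.measurableSet] at hVε
      refine le_trans ?_ hVε.le
      refine le_trans ?_ (mul_measure_lt_conv_le μ x (hV.inter hW) c)
      gcongr
      intro y hy
      refine lt_of_lt_of_le (b := (conv x y : Measure K) N) (hCN hy) ?_
      have := regular_conv x y
      have hae : ∀ᵐ t ∂(conv x y : Measure K), t ∈ W := by
        filter_upwards [Measure.support_mem_ae_of_regular (μ := (conv x y : Measure K))] with t ht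
        exact hsub y hy ht
      exact measure_mono_ae (by filter_upwards [hae] with t ht htN using ⟨hNV htN, ht⟩)
    have : c * μ C = 0 := by
      by_contra hne
      obtain ⟨ε, h1, h2⟩ := exists_between (pos_iff_ne_zero.2 hne)
      exact absurd (hle ε h1.ne') (not_le.2 h2)
    exact (mul_eq_zero.1 this).resolve_left hc0
  rw [ae_iff]
  refine measure_mono_null (t := ⋃ n : ℕ, {y | ((n : ℝ≥0∞) + 1)⁻¹ < (conv x y : Measure K) N})
    (fun y hy => ?_) (measure_iUnion_null fun n => hc _ (by simp) (by simp))
  obtain ⟨n, hn⟩ := ENNReal.exists_inv_nat_lt (show (conv x y : Measure K) N ≠ 0 from hy)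
  exact Set.mem_iUnion.2 ⟨n, lt_of_le_of_lt (ENNReal.inv_le_inv.2 le_self_add) hn⟩

lemma ae_conv_of_ae (μ : Measure K) [IsHaar μ] (x : K) {p : K → Prop} (hp : ∀ᵐ t ∂μ, p t) :
    ∀ᵐ y ∂μ, ∀ᵐ t ∂(conv x y : Measure K), p t := by
  filter_upwards [ae_conv_eq_zero μ x (measurableSet_toMeasurable μ {t | ¬ p t})
    (by rw [measure_toMeasurable]; exact hp)] with y hy
  exact measure_mono_null (subset_toMeasurable μ _) hy

lemma memLp_translate (μ : Measure K) [IsHaar μ] (x : K) (φ : Lp ℂ ∞ μ) :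
    MemLp (fun y => ∫ t, φ t ∂(conv x y : Measure K)) ∞ μ := by
  have hφ : ∀ᵐ t ∂μ, ‖φ t‖ ≤ ‖φ‖ := by
    have h := ae_le_eLpNormEssSup (f := φ) (μ := μ)
    rw [← eLpNorm_exponent_top, ← Lp.enorm_def] at h
    filter_upwards [h] with t ht using by simpa [enorm_le_iff_norm_le] using ht
  refine memLp_top_of_bound (C := ‖φ‖) ?_ ?_
  · exact ((Lp.stronglyMeasurable φ).integral_kernel (κ := convKernel x)).aestronglyMeasurable
  · filter_upwards [ae_conv_of_ae μ x hφ] with y hy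
    simpa using norm_integral_le_of_norm_le_const hy

/-- The translation `T_x φ (y) = ∫ φ dω(x, y)` on `L^∞(K)`. -/
def translateLinfty (μ : Measure K) [IsHaar μ] (x : K) (φ : Lp ℂ ∞ μ) : Lp ℂ ∞ μ :=
  (memLp_translate μ x φ).toLp _

/-- `T_x φ` does not depend on the representative of `φ`. -/
lemma translateLinfty_toLp (μ : Measure K) [IsHaar μ] (x : K) {f : K → ℂ} (hf : MemLp f ∞ μ) :
    translateLinfty μ x (hf.toLp f) =ᵐ[μ] fun y => ∫ t, f t ∂(conv x y : Measure K) := by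
  refine (MemLp.coeFn_toLp _).trans ?_
  filter_upwards [ae_conv_of_ae μ x hf.coeFn_toLp] with y hy
  exact integral_congr_ae hy

end Linfty

/-- The class in `L^∞(K)` of a bounded continuous function. -/
def toLinfty (μ : Measure K) (f : K →ᵇ ℂ) : Lp ℂ ∞ μ :=
  (memLp_top_of_bound f.continuous.aestronglyMeasurable ‖f‖
    (Filter.Eventually.of_forall f.norm_coe_le_norm)).toLp f

/-- An `α`-mean on a space `X` of functions on `K`, where `T` is the translation on `X` and `a ∈ X`
is `α`, seen as an element of `X`: a bounded linear functional `M` on `X` with `M(α) = 1` and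
`M(T_x f) = α(x) M(f)`. -/
structure IsAlphaMean {X : Type*} [NormedAddCommGroup X] [NormedSpace ℂ X] (α : K → ℂ) (a : X)
    (T : K → X → X) (M : X →L[ℂ] ℂ) : Prop where
  map_char : M a = 1
  map_translate : ∀ (x : K) (f : X), M (T x f) = α x * M f

/-- `M` is an `α`-mean on `UC(K)`. -/
def IsAlphaMeanUC [CommHypergroup K] {α : K →ᵇ ℂ} (hα : α ∈ Dual K) (M : UC K →L[ℂ] ℂ) : Prop :=
  IsAlphaMean α ⟨α, dual_subset_UC hα⟩ translateUC M

/-- `M` is an `α`-mean on `L^∞(K)`. -/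
def IsAlphaMeanLinfty [T2Space K] [LocallyCompactSpace K] [CommHypergroup K] (μ : Measure K)
    [IsHaar μ] (α : K →ᵇ ℂ) (M : Lp ℂ ∞ μ →L[ℂ] ℂ) : Prop :=
  IsAlphaMean α (toLinfty μ α) (translateLinfty μ) M

/-- `UC(K)` is `α`-amenable. -/
def UCAmenable [CommHypergroup K] {α : K →ᵇ ℂ} (hα : α ∈ Dual K) : Prop :=
  ∃ M : UC K →L[ℂ] ℂ, IsAlphaMeanUC hα M

/-- `K` is `α`-amenable, that is, `L^∞(K)` is `α`-amenable. -/
def Amenable [T2Space K] [LocallyCompactSpace K] [CommHypergroup K] (μ : Measure K)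
    [IsHaar μ] (α : K →ᵇ ℂ) : Prop :=
  ∃ M : Lp ℂ ∞ μ →L[ℂ] ℂ, IsAlphaMeanLinfty μ α M

/-- The Fourier transform `ĝ(α) = ∫ conj (α) g dμ` of `g ∈ L^1(K)`. -/
def fourier (μ : Measure K) (g : Lp ℂ 1 μ) (α : K →ᵇ ℂ) : ℂ :=
  ∫ x, conj (α x) * g x ∂μ

/-- The convolution `(φ * g)(x) = ∫ φ(y) T_{ỹ} g(x) dμ(y)` of `φ ∈ L^∞(K)` and `g ∈ L^1(K)`. -/
def convolution [Hypergroup K] (μ : Measure K) (φ : Lp ℂ ∞ μ) (g : Lp ℂ 1 μ) (x : K) : ℂ :=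
  ∫ y, φ y * ∫ t, g t ∂(conv (invol y) x : Measure K) ∂μ

end

end Hypergroup

/-! An `α`-mean on `L^∞(K)` restricts to one on `UC(K)`, because the embedding of `C^b(K)` into
`L^∞(K)` commutes with translations. Conversely, convolution with a fixed `g ∈ L^1(K)` maps `L^∞(K)`
into `UC(K)` and satisfies `(T_x φ) * g = T_x (φ * g)` (`convL_mem_UC`, `convL_translateLinfty`), so
`φ ↦ m(φ * g)` inherits the translation rule from `m`. For `f ∈ UC(K)` and `g ∈ C_c(K)` the function
`f * g` is the vector-valued integral `∫ g(s) T_{s̃} f dμ(s)` in `UC(K)`. The functional `m` may be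
taken inside, and `α(s̃) = conj (α(s))` gives `m(f * g) = ĝ(α) m(f)`; density of `C_c(K)` extends
this to all `g` (`mean_convUC`). With `ĝ(α) = 1` the new functional extends `m`, and `f = α` gives
the normalization. Such a `g` is a multiple of `α χ` with `χ` a bump at the identity.

The analytic weight lies in the Haar measure, whose invariance is assumed only for nonnegative
functions in `C_c(K)`. The central fact is that `T_{x̃}` is the adjoint of `T_x`
(`integral_translate_mul`). If `f` and `g` are smeared with a symmetric `k ∈ C_c(K)`, this is
Fubini's theorem together with the symmetry of the kernel `T_{s̃} k(y)`; letting `k` run through an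
approximate unit removes the smearing. That limit rests on the support rule `mem_support_conv_symm`.
Integrating the adjoint relation over `x` shows that `μ` is invariant under the involution. Inner
regularity then extends the statements from `C_c(K)` to `L^1(K)` and `L^∞(K)`
(`bind_convKernel_le`), without any `σ`-finiteness: Fubini is used only for continuous functions of
compact support, and elsewhere integrals are exchanged through Bochner integrals in `C^b(K)`. -/

namespace Hypergroup

noncomputable section

/-- Urysohn functions in `C_c(K)`. -/
lemma exists_bump {K : Type*} [TopologicalSpace K] [T2Space K] [LocallyCompactSpace K]
    {C U : Set K} (hC : IsCompact C) (hU : IsOpen U) (hCU : C ⊆ U) :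
    ∃ f : K →ᵇ ℂ, HasCompactSupport f ∧ (∀ t, f t = (‖f t‖ : ℂ)) ∧ (∀ t ∈ C, f t = 1) ∧
      (∀ t ∉ U, f t = 0) ∧ ∀ t, ‖f t‖ ≤ 1 := by
  obtain ⟨f, h1, h0, hs, hf⟩ := exists_continuous_one_zero_of_isCompact hC hU.isClosed_compl
    (Set.disjoint_compl_right_iff_subset.2 hCU)
  refine ⟨BoundedContinuousFunction.ofNormedAddCommGroup (fun t => ((f t : ℝ) : ℂ))
    (Complex.continuous_ofReal.comp f.continuous) 1 fun t => ?_, ?_, fun t => ?_,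
    fun t ht => ?_, fun t ht => ?_, fun t => ?_⟩
  · simpa [abs_of_nonneg (hf t).1] using (hf t).2
  · exact hs.comp_left (g := ((↑) : ℝ → ℂ)) Complex.ofReal_zero
  · simp [abs_of_nonneg (hf t).1]
  · simp [h1 ht]
  · simp [h0 (show t ∈ Uᶜ from ht)]
  · simpa [abs_of_nonneg (hf t).1] using (hf t).2

variable {K : Type*} [TopologicalSpace K] [MeasurableSpace K] [BorelSpace K]

/-! ### Supports of `ω(x, y)` and translates of functions in `C_c(K)` -/

section supports

variable [Hypergroup K]

lemma support_mem_ae_conv (x y : K) :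
    ∀ᵐ t ∂(conv x y : Measure K), t ∈ (conv x y : Measure K).support := by
  have := regular_conv x y
  exact Measure.support_mem_ae_of_regular

lemma translate_eq_zero {x y : K} {f : K →ᵇ ℂ}
    (h : ∀ t ∈ (conv x y : Measure K).support, f t = 0) : translate x f y = 0 := by
  rw [translate_apply]
  refine integral_eq_zero_of_ae ?_
  filter_upwards [support_mem_ae_conv x y] with t ht using h t ht

lemma exists_mem_support_of_translate_ne_zero {x y : K} {f : K →ᵇ ℂ} (h : translate x f y ≠ 0) :
    ∃ t ∈ (conv x y : Measure K).support, f t ≠ 0 := by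
  by_contra! hn
  exact h (translate_eq_zero hn)

/-- The condition `f t = ‖f t‖` is the form in which nonnegativity of a complex-valued function is
used throughout; it passes to translates and turns complex integrals into integrals of norms. -/
lemma translate_apply_of_nonneg {f : K →ᵇ ℂ} (hf : ∀ t, f t = (‖f t‖ : ℂ)) (x y : K) :
    translate x f y = ((∫ t, ‖f t‖ ∂(conv x y : Measure K) : ℝ) : ℂ) := by
  rw [translate_apply, ← integral_complex_ofReal]
  exact integral_congr_ae (Filter.Eventually.of_forall hf)

/-- A translate of a nonnegative function is nonnegative. -/
lemma translate_nonneg {f : K →ᵇ ℂ} (hf : ∀ t, f t = (‖f t‖ : ℂ)) (x y : K) :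
    translate x f y = (‖translate x f y‖ : ℂ) := by
  have h0 : 0 ≤ ∫ t, ‖f t‖ ∂(conv x y : Measure K) := integral_nonneg fun t => norm_nonneg _
  rw [translate_apply_of_nonneg hf, Complex.norm_real, Real.norm_of_nonneg h0]

lemma translate_ne_zero_of_mem_support {x y t : K} {f : K →ᵇ ℂ} (hf : ∀ t, f t = (‖f t‖ : ℂ))
    (ht : t ∈ (conv x y : Measure K).support) (hft : f t ≠ 0) : translate x f y ≠ 0 := by
  rw [translate_apply_of_nonneg hf, Complex.ofReal_ne_zero]
  refine ne_of_gt ?_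
  rw [integral_pos_iff_support_of_nonneg (fun t => norm_nonneg _) (integrable_conv f x y).norm]
  refine Measure.mem_support_iff_forall t |>.1 ht _ ?_
  have : Function.support (fun t => ‖f t‖) = {t | f t ≠ 0} := by ext; simp
  rw [this]
  exact (isOpen_ne_fun f.continuous continuous_const).mem_nhds hft

lemma isOpen_support_subset {U : Set K} (hU : IsOpen U) :
    IsOpen {p : K × K | (conv p.1 p.2 : Measure K).support ⊆ U} :=
  @IsOpen.preimage _ _ _ (TopologicalSpace.vietoris K) _ continuous_support _ hU.powerset_vietoris

lemma mem_support_invol {x y t : K} (h : t ∈ (conv x y : Measure K).support) :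
    invol t ∈ (conv (invol y) (invol x) : Measure K).support := by
  rw [Measure.mem_support_iff_forall] at h ⊢
  intro U hU
  obtain ⟨V, hVU, hV, htV⟩ := mem_nhds_iff.1 hU
  refine lt_of_lt_of_le ?_ (measure_mono hVU)
  rw [← map_invol_conv, Measure.map_apply continuous_invol.measurable hV.measurableSet]
  exact h _ ((hV.preimage continuous_invol).mem_nhds htV)

lemma support_conv_one [T2Space K] (x : K) : (conv x one : Measure K).support = {x} := by
  rw [conv_one]
  ext y
  rw [Measure.mem_support_iff_forall, Set.mem_singleton_iff]
  constructor
  · intro h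
    by_contra hne
    have := h {x}ᶜ (isOpen_compl_singleton.mem_nhds hne)
    rw [Measure.dirac_apply' _ (measurableSet_singleton x).compl] at this
    simp at this
  · rintro rfl U hU
    rw [Measure.dirac_apply_of_mem (mem_of_mem_nhds hU)]
    exact one_pos

variable (K) in
/-- The involution as a homeomorphism. -/
def involHomeomorph : K ≃ₜ K where
  toFun := invol
  invFun := invol
  left_inv := invol_invol
  right_inv := invol_invol
  continuous_toFun := continuous_invol
  continuous_invFun := continuous_invol

lemma continuous_translate_apply (f : K →ᵇ ℂ) :
    Continuous fun p : K × K => translate p.1 f p.2 :=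
  continuous_iff_continuousAt.2 fun p =>
    (ProbabilityMeasure.tendsto_iff_forall_integral_rclike_tendsto ℂ).1
      (continuous_conv.tendsto p) f

variable [T2Space K] [LocallyCompactSpace K]

/-- `t ∈ supp ω(x, y)` implies `y ∈ supp ω(x̃, t)`. -/
lemma mem_support_conv_symm {x y t : K} (h : t ∈ (conv x y : Measure K).support) :
    y ∈ (conv (invol x) t : Measure K).support := by
  suffices H : invol y ∈ (conv (invol t) x : Measure K).support by
    simpa [invol_invol] using mem_support_invol H
  by_contra hn
  -- No `s` in this support equals `ỹ`, so the identity is never in `supp ω(s, y)`; compactness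
  -- makes the separation uniform in `s`.
  obtain ⟨V, hV, hdisj⟩ : ∃ V ∈ 𝓝 (one : K), ∀ s ∈ (conv (invol t) x : Measure K).support,
      Disjoint (conv s y : Measure K).support V := by
    refine (isCompact_support (invol t) x).induction_on
      (p := fun C => ∃ V ∈ 𝓝 (one : K), ∀ s ∈ C, Disjoint (conv s y : Measure K).support V)
      ?_ ?_ ?_ ?_
    · exact ⟨Set.univ, Filter.univ_mem, by simp⟩
    · rintro s t hst ⟨V, hV, h⟩
      exact ⟨V, hV, fun z hz => h z (hst hz)⟩
    · rintro s t ⟨V, hV, h⟩ ⟨V', hV', h'⟩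
      refine ⟨V ∩ V', Filter.inter_mem hV hV', ?_⟩
      rintro z (hz | hz)
      · exact (h z hz).mono_right Set.inter_subset_left
      · exact (h' z hz).mono_right Set.inter_subset_right
    · intro s hs
      have h1 : (one : K) ∉ (conv s y : Measure K).support := by
        rw [one_mem_support_iff]
        rintro rfl
        exact hn (by rwa [invol_invol])
      obtain ⟨U, V, hU, hV, hsU, hVone, hUV⟩ := SeparatedNhds.of_isCompact_isCompact
        (isCompact_support s y) (isCompact_singleton (x := (one : K)))
        (Set.disjoint_singleton_right.2 h1)
      have hmem : {z | (conv z y : Measure K).support ⊆ U} ∈ 𝓝 s :=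
        ((isOpen_support_subset hU).preimage (Continuous.prodMk_left y)).mem_nhds hsU
      exact ⟨_, mem_nhdsWithin_of_mem_nhds hmem, V, hV.mem_nhds (hVone rfl),
        fun z hz => hUV.mono_left hz⟩
  obtain ⟨f, -, hf, hf1, hf0, -⟩ := exists_bump (isCompact_singleton (x := (one : K)))
    isOpen_interior (Set.singleton_subset_iff.2 (mem_interior_iff_mem_nhds.2 hV))
  -- The integral of `T_{t̃} f` over `ω(x, y)` is nonzero, since `t` lies in the support and the
  -- identity lies in `supp ω(t̃, t)`. By associativity it is also the average of `T_s f(y)` over `s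
  -- ∈ supp ω(t̃, x)`, where each term vanishes.
  have h1 : translate (invol t) f t ≠ 0 :=
    translate_ne_zero_of_mem_support hf
      ((one_mem_support_iff _ _).2 (invol_invol t).symm) (by simp [hf1])
  have h2 : translate x (translate (invol t) f) y ≠ 0 :=
    translate_ne_zero_of_mem_support (translate_nonneg hf _) h h1
  refine h2 ((conv_assoc (invol t) x y f).trans ?_)
  refine integral_eq_zero_of_ae ?_
  filter_upwards [support_mem_ae_conv (invol t) x] with s hs
  refine translate_eq_zero fun z hz => hf0 z fun hzV => ?_
  exact Set.disjoint_left.1 (hdisj s hs) hz (interior_subset hzV)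

lemma exists_isCompact_support_subset {A C : Set K} (hA : IsCompact A) (hC : IsCompact C) :
    ∃ W : Set K, IsCompact W ∧ ∀ x ∈ A, ∀ y ∈ C, (conv x y : Measure K).support ⊆ W := by
  obtain ⟨W, hW, h⟩ : ∃ W : Set K, IsCompact W ∧
      ∀ p ∈ A ×ˢ C, (conv p.1 p.2 : Measure K).support ⊆ W := by
    refine (hA.prod hC).induction_on (p := fun D => ∃ W : Set K, IsCompact W ∧
      ∀ p ∈ D, (conv p.1 p.2 : Measure K).support ⊆ W) ?_ ?_ ?_ ?_
    · exact ⟨∅, isCompact_empty, by simp⟩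
    · rintro s t hst ⟨W, h1, h2⟩
      exact ⟨W, h1, fun p hp => h2 p (hst hp)⟩
    · rintro s t ⟨W, h1, h2⟩ ⟨V, k1, k2⟩
      refine ⟨W ∪ V, h1.union k1, ?_⟩
      rintro p (hp | hp)
      · exact (h2 p hp).trans Set.subset_union_left
      · exact (k2 p hp).trans Set.subset_union_right
    · intro p _
      obtain ⟨W, hW, hsub, hWc⟩ :=
        exists_isOpen_superset_and_isCompact_closure (isCompact_support p.1 p.2)
      exact ⟨_, mem_nhdsWithin_of_mem_nhds ((isOpen_support_subset hW).mem_nhds hsub),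
        closure W, hWc, fun q hq => (show _ ⊆ W from hq).trans subset_closure⟩
  exact ⟨W, hW, fun x hx y hy => h (x, y) ⟨hx, hy⟩⟩

/-- The translates of `f ∈ C_c(K)` by elements of a compact set are supported in a common compact
set. -/
lemma exists_isCompact_translate_eq_zero {f : K →ᵇ ℂ} (hf : HasCompactSupport f) {A : Set K}
    (hA : IsCompact A) : ∃ W : Set K, IsCompact W ∧ ∀ x ∈ A, ∀ y ∉ W, translate x f y = 0 := by
  obtain ⟨W, hW, h⟩ := exists_isCompact_support_subset (hA.image continuous_invol) hf
  refine ⟨W, hW, fun x hx y hy => translate_eq_zero fun t ht => ?_⟩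
  by_contra hft
  exact hy (h _ (Set.mem_image_of_mem _ hx) t (subset_tsupport _ hft) (mem_support_conv_symm ht))

lemma hasCompactSupport_translate {f : K →ᵇ ℂ} (hf : HasCompactSupport f) (x : K) :
    HasCompactSupport (translate x f) := by
  obtain ⟨W, hW, h⟩ := exists_isCompact_translate_eq_zero hf (isCompact_singleton (x := x))
  exact HasCompactSupport.intro hW fun y hy => h x rfl y hy

/-- `C_c(K) ⊆ UC(K)`. -/
lemma mem_UC_of_hasCompactSupport {f : K →ᵇ ℂ} (hf : HasCompactSupport f) : f ∈ UC K := by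
  refine continuous_iff_continuousAt.2 fun x₀ => ?_
  obtain ⟨A, hA, hxA⟩ := exists_compact_mem_nhds x₀
  obtain ⟨W, hW, h⟩ := exists_isCompact_translate_eq_zero hf hA
  refine Metric.tendsto_nhds.2 fun ε hε => ?_
  -- Joint continuity of `T_x f(y)` and compactness of `W` give uniformity in `y ∈ W`; off `W` both
  -- translates vanish.
  have hev : ∀ y ∈ W, ∀ᶠ p : K × K in 𝓝 (x₀, y),
      dist (translate p.1 f p.2) (translate x₀ f p.2) < ε / 2 := by
    intro y _
    have hc : Continuous fun p : K × K => dist (translate p.1 f p.2) (translate x₀ f p.2) :=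
      (continuous_translate_apply f).dist ((translate x₀ f).continuous.comp continuous_snd)
    exact hc.continuousAt.eventually_lt continuousAt_const (by simpa using half_pos hε)
  filter_upwards [hW.eventually_forall_of_forall_eventually (P := fun x y =>
    dist (translate x f y) (translate x₀ f y) < ε / 2) hev, hxA] with x hx hxA'
  refine lt_of_le_of_lt ?_ (half_lt_self hε)
  refine (BoundedContinuousFunction.dist_le (half_pos hε).le).2 fun y => ?_
  by_cases hy : y ∈ W
  · exact (hx y hy).le
  · rw [h x hxA' y hy, h x₀ (mem_of_mem_nhds hxA) y hy, dist_self]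
    exact (half_pos hε).le

end supports

/-! ### Translation operators and reflection in the commutative case -/

section translation

/-- The translation `T_x` on `C^b(K)` as a continuous linear map. -/
def translateL [Hypergroup K] (x : K) : (K →ᵇ ℂ) →L[ℂ] (K →ᵇ ℂ) :=
  LinearMap.mkContinuous
    { toFun := translate x
      map_add' := translate_add x
      map_smul' := translate_smul x } 1 fun f => by simpa using norm_translate_le x f

@[simp]
lemma translateL_apply [Hypergroup K] (x : K) (f : K →ᵇ ℂ) : translateL x f = translate x f := rfl

/-- The function `x ↦ f(x̃)`. -/
def reflect [Hypergroup K] (f : K →ᵇ ℂ) : K →ᵇ ℂ := f.compContinuous ⟨invol, continuous_invol⟩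

@[simp]
lemma reflect_apply [Hypergroup K] (f : K →ᵇ ℂ) (x : K) : reflect f x = f (invol x) := rfl

lemma hasCompactSupport_reflect [Hypergroup K] {f : K →ᵇ ℂ} (hf : HasCompactSupport f) :
    HasCompactSupport (reflect f) :=
  hf.comp_homeomorph (involHomeomorph K)

lemma invol_one [Hypergroup K] [T2Space K] : invol (one : K) = one := by
  have h : (one : K) ∈ (conv (one : K) one : Measure K).support := by simp [support_conv_one]
  exact ((one_mem_support_iff _ _).1 h).symm

variable [CommHypergroup K]

lemma translate_apply_comm (x y : K) (f : K →ᵇ ℂ) : translate x f y = translate y f x := by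
  rw [translate_apply, translate_apply, CommHypergroup.conv_comm]

lemma translate_comm (x z : K) (f : K →ᵇ ℂ) :
    translate z (translate x f) = translate x (translate z f) := by
  ext y
  have h1 := conv_assoc x z y f
  have h2 := conv_assoc z x y f
  rw [CommHypergroup.conv_comm z x] at h2
  exact h1.trans h2.symm

lemma translate_reflect (x : K) (f : K →ᵇ ℂ) :
    translate x (reflect f) = reflect (translate (invol x) f) := by
  ext y
  rw [reflect_apply, translate_apply, translate_apply, CommHypergroup.conv_comm (invol x),
    ← map_invol_conv, integral_map continuous_invol.aemeasurable
      f.continuous.aestronglyMeasurable]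
  rfl

/-- Exchanges the translating element with the argument. For `f = reflect f` it says that the kernel
`(x, y) ↦ T_{x̃} f(y)` is symmetric. -/
lemma translate_invol_apply (x y : K) (f : K →ᵇ ℂ) :
    translate (invol x) f y = translate (invol y) (reflect f) x := by
  rw [translate_reflect, reflect_apply, invol_invol, translate_apply_comm]

end translation

/-! ### Concentration near the diagonal -/

section concentration

variable [CommHypergroup K] [T2Space K] [LocallyCompactSpace K]

/-- If `supp ω(s̃, y)` meets a small neighborhood of the identity, then `s` and `y` are close to each
other. -/
lemma exists_nhds_one_norm_sub_le {f : K →ᵇ ℂ} (hf : HasCompactSupport f) {ε : ℝ} (hε : 0 < ε) :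
    ∀ᶠ v in 𝓝 (one : K), ∀ s y, v ∈ (conv (invol s) y : Measure K).support → ‖f s - f y‖ ≤ ε := by
  have key : ∀ᶠ v in 𝓝 (one : K), ∀ a ∈ tsupport f,
      ∀ b ∈ (conv a v : Measure K).support, ‖f a - f b‖ ≤ ε := by
    refine hf.isCompact.eventually_forall_of_forall_eventually
      (P := fun v a => ∀ b ∈ (conv a v : Measure K).support, ‖f a - f b‖ ≤ ε) fun a₀ _ => ?_
    have hU : IsOpen {b | ‖f b - f a₀‖ < ε / 2} :=
      isOpen_lt (f.continuous.sub continuous_const).norm continuous_const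
    have h1 : ∀ᶠ p : K × K in 𝓝 (one, a₀),
        (conv p.2 p.1 : Measure K).support ⊆ {b | ‖f b - f a₀‖ < ε / 2} := by
      refine ((isOpen_support_subset hU).preimage continuous_swap).mem_nhds ?_
      change (conv a₀ one : Measure K).support ⊆ _
      rw [support_conv_one]
      simpa using hε
    have h2 : ∀ᶠ p : K × K in 𝓝 (one, a₀), ‖f p.2 - f a₀‖ < ε / 2 :=
      (hU.preimage continuous_snd).mem_nhds (by simpa using hε)
    filter_upwards [h1, h2] with p h1 h2 b hb
    have h3 : ‖f b - f a₀‖ < ε / 2 := h1 hb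
    calc ‖f p.2 - f b‖ = ‖(f p.2 - f a₀) - (f b - f a₀)‖ := by congr 1; ring
      _ ≤ ‖f p.2 - f a₀‖ + ‖f b - f a₀‖ := norm_sub_le _ _
      _ ≤ ε := by linarith
  -- The estimate in `key` starts from a point of `supp f`. If that point is `y` instead of `s`, the
  -- roles are exchanged and `v` is replaced by `ṽ`.
  have key' := (continuous_invol.tendsto' (one : K) one invol_one).eventually key
  filter_upwards [key, key'] with v h h' s y hv
  have hy : y ∈ (conv s v : Measure K).support := by
    simpa [invol_invol] using mem_support_conv_symm hv
  by_cases hs : s ∈ tsupport f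
  · exact h s hs y hy
  by_cases hyf : y ∈ tsupport f
  · rw [norm_sub_rev]
    refine h' y hyf s ?_
    rw [CommHypergroup.conv_comm] at hy ⊢
    exact mem_support_conv_symm hy
  · simp [image_eq_zero_of_notMem_tsupport hs, image_eq_zero_of_notMem_tsupport hyf, hε.le]

end concentration

/-! ### Positivity of the Haar measure and approximate units -/

section haar

lemma integral_eq_of_nonneg {X : Type*} [MeasurableSpace X] {f : X → ℂ}
    (hf : ∀ t, f t = (‖f t‖ : ℂ)) (μ : Measure X) :
    ∫ t, f t ∂μ = ((∫ t, ‖f t‖ ∂μ : ℝ) : ℂ) := by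
  rw [← integral_complex_ofReal]
  exact integral_congr_ae (Filter.Eventually.of_forall hf)

lemma enorm_translate_of_nonneg [Hypergroup K] {f : K →ᵇ ℂ} (hf : ∀ t, f t = (‖f t‖ : ℂ))
    (x y : K) : ‖translate x f y‖ₑ = ∫⁻ t, ‖f t‖ₑ ∂(conv x y : Measure K) := by
  have h0 : 0 ≤ ∫ t, ‖f t‖ ∂(conv x y : Measure K) := integral_nonneg fun t => norm_nonneg _
  rw [← ofReal_integral_norm_eq_lintegral_enorm (integrable_conv f x y),
    translate_apply_of_nonneg hf, ← ofReal_norm, Complex.norm_real, Real.norm_of_nonneg h0]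

/-- Invariance of the Haar measure, for nonnegative `f ∈ C_c(K)`. -/
lemma integral_norm_translate [Hypergroup K] (μ : Measure K) [IsHaar μ] {f : K →ᵇ ℂ}
    (hfc : HasCompactSupport f) (hf : ∀ t, f t = (‖f t‖ : ℂ)) (x : K) :
    ∫ y, ‖translate x f y‖ ∂μ = ∫ y, ‖f y‖ ∂μ := by
  rw [integral_norm_eq_lintegral_enorm (translate x f).continuous.aestronglyMeasurable,
    integral_norm_eq_lintegral_enorm f.continuous.aestronglyMeasurable]
  congr 1
  simp only [enorm_translate_of_nonneg hf]
  exact IsHaar.lintegral_translate x (fun t => ‖f t‖₊) f.continuous.nnnorm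
    (hfc.comp_left (g := fun z => ‖z‖₊) nnnorm_zero)

lemma integral_translate_of_nonneg [Hypergroup K] (μ : Measure K) [IsHaar μ] {f : K →ᵇ ℂ}
    (hfc : HasCompactSupport f) (hf : ∀ t, f t = (‖f t‖ : ℂ)) (x : K) :
    ∫ y, translate x f y ∂μ = ∫ y, f y ∂μ := by
  rw [integral_eq_of_nonneg hf, integral_eq_of_nonneg (translate_nonneg hf x),
    integral_norm_translate μ hfc hf]

lemma integrable_of_cc (μ : Measure K) [IsFiniteMeasureOnCompacts μ] {f : K →ᵇ ℂ}
    (hf : HasCompactSupport f) : Integrable f μ :=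
  f.continuous.integrable_of_hasCompactSupport hf

variable [T2Space K] [LocallyCompactSpace K]

/-- The Haar measure charges neighborhoods of the identity. -/
lemma integral_norm_pos [Hypergroup K] (μ : Measure K) [IsHaar μ] {f : K →ᵇ ℂ}
    (hfc : HasCompactSupport f) (hf : ∀ t, f t = (‖f t‖ : ℂ)) (h1 : f one ≠ 0) :
    0 < ∫ y, ‖f y‖ ∂μ := by
  refine (integral_nonneg fun t => norm_nonneg _).lt_of_ne' fun h0 => ?_
  refine IsHaar.ne_zero (μ := μ) ?_
  -- If `f` had integral zero, so would `T_{s̃} f`, which is nonzero near `s`. Every point would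
  -- then have a null neighborhood, and inner regularity would force `μ = 0`.
  have hnull : ∀ s : K, ∃ U ∈ 𝓝 s, μ U = 0 := by
    intro s
    have hs : translate (invol s) f s ≠ 0 :=
      translate_ne_zero_of_mem_support hf ((one_mem_support_iff _ _).2 (invol_invol s).symm) h1
    refine ⟨{y | translate (invol s) f y ≠ 0}, (isOpen_ne_fun (translate (invol s) f).continuous
      continuous_const).mem_nhds hs, ?_⟩
    have h := integral_norm_translate μ hfc hf (invol s)
    rw [h0, integral_eq_zero_iff_of_nonneg (fun t => norm_nonneg _)
      (integrable_of_cc μ (hasCompactSupport_translate hfc _)).norm] at h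
    refine measure_mono_null (fun y hy => ?_) (ae_iff.1 h)
    simpa using hy
  by_contra hμ
  obtain ⟨C, hC, hne⟩ := Measure.InnerRegular.exists_isCompact_not_null.2 hμ
  refine hne (hC.measure_zero_of_nhdsWithin fun s _ => ?_)
  obtain ⟨U, hU, h⟩ := hnull s
  exact ⟨U, mem_nhdsWithin_of_mem_nhds hU, h⟩

/-- Symmetric approximate units. -/
lemma exists_approximate_unit [Hypergroup K] (μ : Measure K) [IsHaar μ] {V : Set K}
    (hV : V ∈ 𝓝 (one : K)) :
    ∃ k : K →ᵇ ℂ, HasCompactSupport k ∧ (∀ t, k t = (‖k t‖ : ℂ)) ∧ reflect k = k ∧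
      (∀ t ∉ V, k t = 0) ∧ ∫ t, ‖k t‖ ∂μ = 1 := by
  have hV' : V ∩ invol ⁻¹' V ∈ 𝓝 (one : K) :=
    Filter.inter_mem hV (continuous_invol.tendsto' (one : K) one invol_one hV)
  obtain ⟨f, hfc, hf, hf1, hf0, -⟩ := exists_bump (isCompact_singleton (x := (one : K)))
    isOpen_interior (Set.singleton_subset_iff.2 (mem_interior_iff_mem_nhds.2 hV'))
  have hf0' : ∀ t ∉ V ∩ invol ⁻¹' V, f t = 0 := fun t ht => hf0 t fun h => ht (interior_subset h)
  -- The sum `f + reflect f` is symmetric by construction, and only its total mass is normalized, so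
  -- invariance of `μ` under the involution is not presupposed.
  have hh : ∀ t, (f + reflect f) t = ((‖f t‖ + ‖f (invol t)‖ : ℝ) : ℂ) := fun t => by
    push_cast
    rw [← hf, ← hf]
    rfl
  have hhc : HasCompactSupport (f + reflect f) := hfc.add (hasCompactSupport_reflect hfc)
  have hh' : ∀ t, (f + reflect f) t = (‖(f + reflect f) t‖ : ℂ) := fun t => by
    rw [hh, Complex.norm_real, Real.norm_of_nonneg (by positivity)]
  have hpos := integral_norm_pos μ hhc hh' (by
    simp [invol_one, hf1])
  set c := ∫ t, ‖(f + reflect f) t‖ ∂μ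
  have hn : ∀ t, ‖((c⁻¹ : ℝ) : ℂ) • (f + reflect f) t‖ = c⁻¹ * ‖(f + reflect f) t‖ := fun t => by
    rw [norm_smul, Complex.norm_real, Real.norm_of_nonneg (inv_nonneg.2 hpos.le)]
  refine ⟨((c⁻¹ : ℝ) : ℂ) • (f + reflect f), ?_, fun t => ?_, ?_, fun t ht => ?_, ?_⟩
  · exact hhc.comp_left (g := fun z => ((c⁻¹ : ℝ) : ℂ) • z) (smul_zero _)
  · rw [BoundedContinuousFunction.smul_apply, hn, hh' t]
    simp
  · ext t
    simp [invol_invol, add_comm]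
  · simp only [BoundedContinuousFunction.smul_apply, BoundedContinuousFunction.add_apply,
      reflect_apply]
    rw [hf0' t fun h => ht h.1, hf0' (invol t) fun h => ht (by simpa [invol_invol] using h.2)]
    simp
  · simp only [BoundedContinuousFunction.smul_apply, hn]
    rw [integral_const_mul]
    exact inv_mul_cancel₀ hpos.ne'

end haar

/-! ### The adjoint of translation, on `C_c(K)` -/

section adjoint

variable [T2Space K] [CommHypergroup K] (μ : Measure K)

/-- The convolution `∫ f(s) T_{s̃} h dμ(s)` as an integral in `C^b(K)`. -/
def smear (f h : K →ᵇ ℂ) : K →ᵇ ℂ := ∫ s, f s • translate (invol s) h ∂μ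

variable [IsHaar μ]

lemma integrable_smear {f h : K →ᵇ ℂ} (hf : HasCompactSupport f) (hh : h ∈ UC K) :
    Integrable (fun s => f s • translate (invol s) h) μ := by
  refine Continuous.integrable_of_hasCompactSupport ?_ ?_
  · exact f.continuous.smul ((show Continuous fun x => translate x h from hh).comp continuous_invol)
  · refine HasCompactSupport.intro hf.isCompact fun s hs => ?_
    rw [image_eq_zero_of_notMem_tsupport hs, zero_smul]

lemma smear_apply {f h : K →ᵇ ℂ} (hf : HasCompactSupport f) (hh : h ∈ UC K) (y : K) :
    smear μ f h y = ∫ s, f s * translate (invol s) h y ∂μ :=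
  ((BoundedContinuousFunction.evalCLM ℂ y).integral_comp_comm (integrable_smear μ hf hh)).symm

lemma translate_smear {f h : K →ᵇ ℂ} (hf : HasCompactSupport f) (hh : h ∈ UC K) (x : K) :
    translate x (smear μ f h) = smear μ f (translate x h) := by
  rw [← translateL_apply, smear, ← (translateL x).integral_comp_comm (integrable_smear μ hf hh)]
  simp only [map_smul, translateL_apply, translate_comm _ x, smear]

variable [LocallyCompactSpace K]

/-- Smearing with an approximate unit. -/
lemma norm_smear_sub_le {f k : K →ᵇ ℂ} (hf : HasCompactSupport f) (hk : HasCompactSupport k)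
    (hk0 : ∀ t, k t = (‖k t‖ : ℂ)) (hkr : reflect k = k) (hk1 : ∫ t, ‖k t‖ ∂μ = 1) {ε : ℝ}
    (hε : 0 ≤ ε)
    (h : ∀ t, k t ≠ 0 → ∀ s y, t ∈ (conv (invol s) y : Measure K).support → ‖f s - f y‖ ≤ ε) :
    ‖smear μ f k - f‖ ≤ ε := by
  refine (BoundedContinuousFunction.norm_le hε).2 fun y => ?_
  -- In this form the integral over `s` is that of a single translate of `k`, hence equal to `1` by
  -- invariance. Thus `f * k - f` at `y` is an average of `f s - f y`.
  have hsymm : ∀ s, translate (invol s) k y = translate (invol y) k s := fun s => by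
    rw [translate_invol_apply, hkr]
  have hkc := hasCompactSupport_translate hk (invol y)
  have hint : Integrable (fun s => translate (invol y) k s) μ := integrable_of_cc μ hkc
  have h1 : ∫ s, translate (invol y) k s ∂μ = 1 := by
    rw [integral_translate_of_nonneg μ hk hk0, integral_eq_of_nonneg hk0, hk1, Complex.ofReal_one]
  have hfint : Integrable (fun s => f s * translate (invol y) k s) μ :=
    Continuous.integrable_of_hasCompactSupport (f.continuous.mul (translate (invol y) k).continuous)
      (HasCompactSupport.mul_right hf)
  have heq : (smear μ f k - f) y = ∫ s, (f s - f y) * translate (invol y) k s ∂μ := by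
    rw [BoundedContinuousFunction.sub_apply, smear_apply μ hf (mem_UC_of_hasCompactSupport hk)]
    simp only [hsymm, sub_mul]
    rw [integral_sub hfint (hint.const_mul _), integral_const_mul, h1, mul_one]
  rw [heq]
  calc ‖∫ s, (f s - f y) * translate (invol y) k s ∂μ‖
      ≤ ∫ s, ε * ‖translate (invol y) k s‖ ∂μ := by
        refine norm_integral_le_of_norm_le (hint.norm.const_mul _)
          (Filter.Eventually.of_forall fun s => ?_)
        rw [norm_mul]
        by_cases hs : translate (invol y) k s = 0
        · simp [hs]
        · rw [← hsymm] at hs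
          obtain ⟨t, ht, hkt⟩ := exists_mem_support_of_translate_ne_zero hs
          exact mul_le_mul_of_nonneg_right (h t hkt s y ht) (norm_nonneg _)
    _ = ε := by
      rw [integral_const_mul, integral_norm_translate μ hk hk0, hk1, mul_one]

/-- Both sides are double integrals of `f(s) g(y)` against the same kernel, since `T_{ỹ} T_{x̃} k(s)
= T_{s̃} T_x k(y)` for symmetric `k`; Fubini's theorem applies because the integrand has compact
support. -/
lemma integral_translate_smear_mul {f g k : K →ᵇ ℂ} (hf : HasCompactSupport f)
    (hg : HasCompactSupport g) (hk : HasCompactSupport k) (hkr : reflect k = k) (x : K) :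
    ∫ y, translate x (smear μ f k) y * g y ∂μ =
      ∫ y, f y * translate (invol x) (smear μ g k) y ∂μ := by
  have hkU := mem_UC_of_hasCompactSupport hk
  have hcont : Continuous fun p : K × K => translate (invol p.1) (translate x k) p.2 :=
    (continuous_translate_apply (translate x k)).comp
      ((continuous_invol.comp continuous_fst).prodMk continuous_snd)
  have hsymm : ∀ s y, translate (invol y) (translate (invol x) k) s =
      translate (invol s) (translate x k) y := by
    intro s y
    rw [translate_invol_apply s y, ← invol_invol x, ← translate_reflect, hkr, invol_invol]
  simp only [translate_smear μ hf hkU, translate_smear μ hg hkU,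
    smear_apply μ hf (translate_mem_UC x hkU), smear_apply μ hg (translate_mem_UC _ hkU),
    ← integral_mul_const, ← integral_const_mul, hsymm]
  rw [integral_integral_swap_of_hasCompactSupport
    (f := fun y s => f s * translate (invol s) (translate x k) y * g y)]
  · refine integral_congr_ae (Filter.Eventually.of_forall fun s => ?_)
    refine integral_congr_ae (Filter.Eventually.of_forall fun y => ?_)
    simp only
    ring
  · exact ((f.continuous.comp continuous_snd).mul (hcont.comp continuous_swap)).mul
      (g.continuous.comp continuous_fst)
  · refine HasCompactSupport.intro (hg.isCompact.prod hf.isCompact) fun p hp => ?_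
    by_cases h1 : p.1 ∈ tsupport g
    · have h2 : p.2 ∉ tsupport f := fun h2 => hp ⟨h1, h2⟩
      simp [Function.uncurry, image_eq_zero_of_notMem_tsupport h2]
    · simp [Function.uncurry, image_eq_zero_of_notMem_tsupport h1]

/-- The adjoint of `T_x` is `T_{x̃}`, on `C_c(K)`. -/
lemma integral_translate_mul {f g : K →ᵇ ℂ} (hf : HasCompactSupport f) (hg : HasCompactSupport g)
    (x : K) : ∫ y, translate x f y * g y ∂μ = ∫ y, f y * translate (invol x) g y ∂μ := by
  have hbound : ∀ (u v : K →ᵇ ℂ), HasCompactSupport v →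
      ‖∫ y, u y * v y ∂μ‖ ≤ ‖u‖ * ∫ y, ‖v y‖ ∂μ := by
    intro u v hv
    rw [← integral_const_mul]
    refine norm_integral_le_of_norm_le ((integrable_of_cc μ hv).norm.const_mul _)
      (Filter.Eventually.of_forall fun y => ?_)
    rw [norm_mul]
    exact mul_le_mul_of_nonneg_right (u.norm_coe_le_norm y) (norm_nonneg _)
  have hint : ∀ (u v : K →ᵇ ℂ), HasCompactSupport v → Integrable (fun y => u y * v y) μ :=
    fun u v hv => Continuous.integrable_of_hasCompactSupport (u.continuous.mul v.continuous)
      (HasCompactSupport.mul_left hv)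
  have hsub : ∀ (u u' v : K →ᵇ ℂ), HasCompactSupport v →
      ∫ y, u y * v y ∂μ - ∫ y, u' y * v y ∂μ = ∫ y, (u - u') y * v y ∂μ := by
    intro u u' v hv
    rw [← integral_sub (hint u v hv) (hint u' v hv)]
    simp [sub_mul]
  set c := ∫ y, ‖f y‖ ∂μ + ∫ y, ‖g y‖ ∂μ
  have hc : 0 ≤ c := add_nonneg (integral_nonneg fun _ => norm_nonneg _)
    (integral_nonneg fun _ => norm_nonneg _)
  -- Replacing `f` by `f * k` and `g` by `g * k` costs at most `ε ∫ |g|` and `ε ∫ |f|`, together `ε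
  -- c ≤ δ`; the summand `1` below avoids division by zero.
  refine sub_eq_zero.1 (norm_le_zero_iff.1 (le_of_forall_pos_le_add fun δ hδ => ?_))
  set ε := δ / (c + 1)
  have hε : 0 < ε := by positivity
  obtain ⟨k, hk, hk0, hkr, hkV, hk1⟩ := exists_approximate_unit μ
    (Filter.inter_mem (exists_nhds_one_norm_sub_le hf hε) (exists_nhds_one_norm_sub_le hg hε))
  have hkV' := fun t (ht : k t ≠ 0) => not_not.1 (mt (hkV t) ht)
  have hfk := norm_smear_sub_le μ hf hk hk0 hkr hk1 hε.le fun t ht => (hkV' t ht).1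
  have hgk := norm_smear_sub_le μ hg hk hk0 hkr hk1 hε.le fun t ht => (hkV' t ht).2
  have key := integral_translate_smear_mul μ hf hg hk hkr x
  have hT : ∀ (x : K) (u v : K →ᵇ ℂ), ‖translate x u - translate x v‖ ≤ ‖u - v‖ := fun x u v => by
    have := (translateL x).map_sub u v
    simp only [translateL_apply] at this
    rw [← this]
    exact norm_translate_le x _
  have h1 : ‖∫ y, translate x (smear μ f k) y * g y ∂μ - ∫ y, translate x f y * g y ∂μ‖ ≤
      ε * ∫ y, ‖g y‖ ∂μ := by
    rw [hsub _ _ _ hg]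
    exact (hbound _ _ hg).trans (mul_le_mul_of_nonneg_right ((hT _ _ _).trans hfk)
      (integral_nonneg fun _ => norm_nonneg _))
  have h2 : ‖∫ y, f y * translate (invol x) (smear μ g k) y ∂μ -
      ∫ y, f y * translate (invol x) g y ∂μ‖ ≤ ε * ∫ y, ‖f y‖ ∂μ := by
    simp only [mul_comm (f _)]
    rw [hsub _ _ _ hf]
    exact (hbound _ _ hf).trans (mul_le_mul_of_nonneg_right ((hT _ _ _).trans hgk)
      (integral_nonneg fun _ => norm_nonneg _))
  rw [← key] at h2
  have h3 := norm_sub_le (∫ y, translate x (smear μ f k) y * g y ∂μ -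
    ∫ y, f y * translate (invol x) g y ∂μ) (∫ y, translate x (smear μ f k) y * g y ∂μ -
    ∫ y, translate x f y * g y ∂μ)
  rw [sub_sub_sub_cancel_left] at h3
  have h4 : ε * c ≤ δ := by
    rw [div_mul_eq_mul_div, div_le_iff₀ (by positivity)]
    nlinarith
  have h5 : ε * c = ε * ∫ y, ‖f y‖ ∂μ + ε * ∫ y, ‖g y‖ ∂μ := mul_add _ _ _
  linarith

/-- The Haar measure is invariant under the involution. -/
lemma integral_reflect_of_nonneg {g : K →ᵇ ℂ} (hg : HasCompactSupport g)
    (hg0 : ∀ t, g t = (‖g t‖ : ℂ)) : ∫ y, reflect g y ∂μ = ∫ y, g y ∂μ := by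
  -- Only a nonnegative function of integral `1` is needed. Integrating the adjoint relation for `f`
  -- and `g` over `x` leaves `∫ g` on one side and `∫ reflect g` on the other.
  obtain ⟨f, hf, hf0, -, -, hf1⟩ := exists_approximate_unit μ
    (Filter.univ_mem : Set.univ ∈ 𝓝 (one : K))
  have hf1' : ∫ y, f y ∂μ = 1 := by rw [integral_eq_of_nonneg hf0, hf1, Complex.ofReal_one]
  have swap : ∀ (e : K → K), Continuous e → Function.Involutive e → ∀ (u v : K →ᵇ ℂ),
      HasCompactSupport u → HasCompactSupport v →
      ∫ x, ∫ y, translate (e x) u y * v y ∂μ ∂μ = ∫ y, ∫ x, translate (e x) u y * v y ∂μ ∂μ := by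
    intro e he hee u v hu hv
    refine integral_integral_swap_of_hasCompactSupport
      (((continuous_translate_apply u).comp (he.prodMap continuous_id)).mul
        (v.continuous.comp continuous_snd)) ?_
    obtain ⟨W, hW, h⟩ := exists_isCompact_translate_eq_zero hu hv.isCompact
    refine HasCompactSupport.intro ((hW.image he).prod hv.isCompact) fun p hp => ?_
    by_cases h1 : p.2 ∈ tsupport v
    · have h2 : e p.1 ∉ W := fun h2 => hp ⟨⟨_, h2, hee _⟩, h1⟩
      simp [Function.uncurry, translate_apply_comm (e p.1), h _ h1 _ h2]
    · simp [Function.uncurry, image_eq_zero_of_notMem_tsupport h1]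
  have h1 : ∫ x, ∫ y, translate x f y * g y ∂μ ∂μ = ∫ y, g y ∂μ := by
    refine (swap id continuous_id (fun _ => rfl) f g hf hg).trans ?_
    simp only [id, integral_mul_const, translate_apply_comm _ _ f,
      integral_translate_of_nonneg μ hf hf0, hf1', one_mul]
  have h2 : ∫ x, ∫ y, f y * translate (invol x) g y ∂μ ∂μ = ∫ y, reflect g y ∂μ := by
    simp only [mul_comm (f _)]
    rw [swap invol continuous_invol invol_invol g f hg hf]
    simp only [integral_mul_const, translate_invol_apply _ _ g,
      integral_translate_of_nonneg μ (hasCompactSupport_reflect hg) (fun t => hg0 _)]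
    rw [integral_const_mul, hf1', mul_one]
  rw [← h1, ← h2]
  simp only [integral_translate_mul μ hf hg]

end adjoint

end

end Hypergroup

namespace Hypergroup

noncomputable section

/-! ### Inner regular measures and density of `C_c` in `L^1` -/

section radon

variable {X : Type*} [TopologicalSpace X] [MeasurableSpace X]

/-- For indicators this is inner regularity; it passes to sums because the compact sets are
directed, and to increasing limits because suprema commute. It replaces `σ`-finiteness. -/
lemma lintegral_eq_iSup_compacts (μ : Measure X) [μ.InnerRegular] {h : X → ℝ≥0∞}
    (hh : AEMeasurable h μ) :
    ∫⁻ t, h t ∂μ = ⨆ D : TopologicalSpace.Compacts X, ∫⁻ t in D, h t ∂μ := by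
  suffices H : ∀ h : X → ℝ≥0∞, Measurable h →
      ∫⁻ t, h t ∂μ = ⨆ D : TopologicalSpace.Compacts X, ∫⁻ t in D, h t ∂μ by
    rw [lintegral_congr_ae hh.ae_eq_mk, H _ hh.measurable_mk]
    exact iSup_congr fun D => lintegral_congr_ae (ae_restrict_of_ae hh.ae_eq_mk.symm)
  intro h hh
  refine Measurable.ennreal_induction (motive := fun h =>
    ∫⁻ t, h t ∂μ = ⨆ D : TopologicalSpace.Compacts X, ∫⁻ t in D, h t ∂μ) ?_ ?_ ?_ hh
  · intro c s hs
    simp only [lintegral_indicator_const hs, ← ENNReal.mul_iSup, Measure.restrict_apply hs]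
    congr 1
    refine le_antisymm ?_ (iSup_le fun D => measure_mono Set.inter_subset_left)
    rw [hs.measure_eq_iSup_isCompact]
    refine iSup_le fun C => iSup_le fun hCs => iSup_le fun hC => ?_
    refine le_iSup_of_le ⟨C, hC⟩ (measure_mono fun t ht => ⟨hCs ht, ht⟩)
  · intro f g _ hf _ ihf ihg
    simp only [Pi.add_apply, lintegral_add_left hf, ihf, ihg]
    exact ENNReal.iSup_add_iSup_of_monotone (fun _ _ h => lintegral_mono_set h)
      fun _ _ h => lintegral_mono_set h
  · intro f hf hmono ih
    simp only [lintegral_iSup hf hmono, ih]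
    exact iSup_comm

variable [BorelSpace X] [T2Space X]

/-- Countably many compact sets exhaust `B` up to a `μ`-null set, which is also `ν`-null; their
finite unions then approximate `ν B`, even if `ν` is not finite. -/
lemma innerRegular_of_absolutelyContinuous {μ ν : Measure X} [IsFiniteMeasure μ] [μ.InnerRegular]
    (h : ν ≪ μ) : ν.InnerRegular := by
  refine ⟨fun B hB r hr => ?_⟩
  have hC : ∀ n : ℕ, ∃ C ⊆ B, IsCompact C ∧ μ (B \ C) < ((n : ℝ≥0∞) + 1)⁻¹ := fun n =>
    hB.exists_isCompact_sdiff_lt (measure_ne_top μ B) (by simp)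
  choose C hCB hC hlt using hC
  have hnull : μ (B \ ⋃ n, C n) = 0 := by
    by_contra hne
    obtain ⟨n, hn⟩ := ENNReal.exists_inv_nat_lt hne
    refine lt_irrefl _ (hn.trans_le ?_)
    refine (measure_mono (Set.sdiff_subset_sdiff_right (Set.subset_iUnion C n))).trans ?_
    exact (hlt n).le.trans (ENNReal.inv_le_inv.2 le_self_add)
  have hle : ν B ≤ ν (⋃ n, C n) := by
    refine (measure_mono (t := (⋃ n, C n) ∪ (B \ ⋃ n, C n)) fun t ht => ?_).trans
      ((measure_union_le _ _).trans (by rw [h hnull, add_zero]))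
    by_cases h : t ∈ ⋃ n, C n
    · exact Or.inl h
    · exact Or.inr ⟨ht, h⟩
  have hr' := hr.trans_le hle
  rw [measure_iUnion_eq_iSup_accumulate, lt_iSup_iff] at hr'
  obtain ⟨n, hn⟩ := hr'
  refine ⟨Set.accumulate C n, ?_, isCompact_accumulate hC n, hn⟩
  exact Set.iUnion₂_subset fun i _ => hCB i

variable [LocallyCompactSpace X]

/-- Inner regularity of `ν` reduces to compact sets `C`; a Urysohn function between `C` and an open
`U ⊇ C` with `μ U` close to `μ C` gives the comparison. -/
lemma measure_le_of_lintegral_le {μ ν : Measure X} [ν.InnerRegular] [μ.InnerRegular]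
    [IsFiniteMeasureOnCompacts μ]
    (h : ∀ f : X → ℝ≥0, Continuous f → HasCompactSupport f →
      ∫⁻ t, (f t : ℝ≥0∞) ∂ν ≤ ∫⁻ t, (f t : ℝ≥0∞) ∂μ) : ν ≤ μ := by
  refine Measure.le_iff.2 fun s hs => ?_
  rw [hs.measure_eq_iSup_isCompact]
  refine iSup_le fun C => iSup_le fun hCs => iSup_le fun hC => ?_
  refine le_trans (le_of_forall_gt fun r hr => ?_) (measure_mono hCs)
  obtain ⟨U, hCU, hU, hUr⟩ := hC.exists_isOpen_lt_of_lt r hr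
  obtain ⟨f, hfc, -, hf1, hf0, hfle⟩ := exists_bump hC hU hCU
  calc ν C = ∫⁻ t, C.indicator 1 t ∂ν := (lintegral_indicator_one hC.measurableSet).symm
    _ ≤ ∫⁻ t, (‖f t‖₊ : ℝ≥0∞) ∂ν := lintegral_mono fun t => by
        by_cases ht : t ∈ C
        · simp [ht, hf1 t ht]
        · simp [ht]
    _ ≤ ∫⁻ t, (‖f t‖₊ : ℝ≥0∞) ∂μ := h _ f.continuous.nnnorm
        (hfc.comp_left (g := fun z => ‖z‖₊) nnnorm_zero)
    _ ≤ ∫⁻ t, U.indicator 1 t ∂μ := lintegral_mono fun t => by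
        by_cases ht : t ∈ U
        · have : ‖f t‖₊ ≤ 1 := hfle t
          simpa only [ht, Set.indicator_of_mem, Pi.one_apply, ENNReal.coe_le_one_iff] using this
        · simp [ht, hf0 t ht]
    _ = μ U := lintegral_indicator_one hU.measurableSet
    _ < r := hUr

lemma exists_boundedContinuousFunction_eq {X E : Type*} [TopologicalSpace X]
    [NormedAddCommGroup E] {f : X → E} (hf : Continuous f) (hfc : HasCompactSupport f) :
    ∃ F : X →ᵇ E, ⇑F = f := by
  obtain ⟨C, hC⟩ := hf.bounded_above_of_compact_support hfc
  exact ⟨BoundedContinuousFunction.ofNormedAddCommGroup f hf C hC, rfl⟩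

lemma exists_hasCompactSupport_lintegral_sub_indicator_le {μ : Measure X} [μ.InnerRegular]
    [IsFiniteMeasureOnCompacts μ] (c : ℂ) {t : Set X} (ht : MeasurableSet t) (htμ : μ t < ∞)
    {ε : ℝ≥0∞} (hε : ε ≠ 0) : ∃ g : X → ℂ, ∫⁻ a, ‖g a - t.indicator (fun _ => c) a‖ₑ ∂μ ≤ ε ∧
      Continuous g ∧ HasCompactSupport g := by
  -- The error of `c χ` is at most `‖c‖` on each of `t \ s` and `U \ s`, two sets of measure at most
  -- `η`; hence the factor `2 * ‖c‖ₑ`.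
  obtain ⟨η, hη, hηε⟩ := ENNReal.exists_nnreal_pos_mul_lt
    (a := 2 * ‖c‖ₑ) (ENNReal.mul_ne_top (by simp) enorm_ne_top) hε
  have hη' : (η : ℝ≥0∞) ≠ 0 := by simpa using hη.ne'
  obtain ⟨s, hst, hs, hsη⟩ := ht.exists_isCompact_sdiff_lt htμ.ne hη'
  obtain ⟨U, hsU, hU, hUη⟩ := hs.exists_isOpen_lt_add (μ := μ) hη'
  have hUs : μ (U \ s) ≤ η := by
    rw [measure_sdiff hsU hs.measurableSet.nullMeasurableSet hs.measure_lt_top.ne]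
    exact tsub_le_iff_left.2 hUη.le
  obtain ⟨χ, hχ, hχr, hχ1, hχ0, hχle⟩ := exists_bump hs hU hsU
  refine ⟨fun t => c * χ t, ?_, continuous_const.mul χ.continuous,
    HasCompactSupport.intro hχ.isCompact fun a ha => ?_⟩
  swap
  · rw [image_eq_zero_of_notMem_tsupport ha, mul_zero]
  calc ∫⁻ a, ‖c * χ a - t.indicator (fun _ => c) a‖ₑ ∂μ
      ≤ ∫⁻ a, ((t \ s).indicator (fun _ => ‖c‖ₑ) a + (U \ s).indicator (fun _ => ‖c‖ₑ) a) ∂μ := by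
        refine lintegral_mono fun a => ?_
        have hle : ∀ z : ℂ, ‖z‖ ≤ 1 → ‖c * z‖ₑ ≤ ‖c‖ₑ := fun z hz => by
          rw [enorm_le_iff_norm_le, norm_mul]
          exact mul_le_of_le_one_right (norm_nonneg c) hz
        by_cases has : a ∈ s
        · simp [has, hst has, hχ1 a has]
        by_cases hat : a ∈ t
        · refine le_trans ?_ le_self_add
          have : c * χ a - c = c * (χ a - 1) := by ring
          simp only [hat, Set.indicator_of_mem, this, Set.mem_sdiff, has,
            not_false_eq_true, and_self]
          refine hle _ ?_
          rw [hχr, ← Complex.ofReal_one, ← Complex.ofReal_sub, Complex.norm_real, Real.norm_eq_abs,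
            abs_le]
          constructor <;> linarith [hχle a, norm_nonneg (χ a)]
        · refine le_trans ?_ le_add_self
          by_cases haU : a ∈ U
          · simpa [hat, haU, has] using hle _ (hχle a)
          · simp [hat, hχ0 a haU]
    _ = ‖c‖ₑ * μ (t \ s) + ‖c‖ₑ * μ (U \ s) := by
        rw [lintegral_add_left (measurable_const.indicator (ht.diff hs.measurableSet)),
          lintegral_indicator_const (ht.diff hs.measurableSet),
          lintegral_indicator_const (hU.measurableSet.diff hs.measurableSet)]
    _ ≤ ‖c‖ₑ * η + ‖c‖ₑ * η := by gcongr
    _ = η * (2 * ‖c‖ₑ) := by ring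
    _ ≤ ε := hηε.le

/-- `C_c(X)` is dense in `L^1(μ)`. -/
lemma exists_hasCompactSupport_lintegral_sub_le {μ : Measure X} [μ.InnerRegular]
    [IsFiniteMeasureOnCompacts μ] {f : X → ℂ} (hf : Integrable f μ) {ε : ℝ≥0∞} (hε : ε ≠ 0) :
    ∃ g : X →ᵇ ℂ, HasCompactSupport g ∧ ∫⁻ t, ‖f t - g t‖ₑ ∂μ ≤ ε := by
  have h0 : ∀ (c : ℂ) ⦃s : Set X⦄, MeasurableSet s → μ s < ∞ → ∀ {ε : ℝ≥0∞}, ε ≠ 0 →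
      ∃ g : X → ℂ, eLpNorm (g - s.indicator fun _ => c) 1 μ ≤ ε ∧
        (Continuous g ∧ HasCompactSupport g) := by
    intro c s hs hsμ ε hε
    simp only [eLpNorm_one_eq_lintegral_enorm]
    exact exists_hasCompactSupport_lintegral_sub_indicator_le c hs hsμ hε
  obtain ⟨g, hgε, hgc, hg⟩ := MemLp.induction_dense ENNReal.one_ne_top
    (fun g => Continuous g ∧ HasCompactSupport g) h0
    (fun f g hf hg => ⟨hf.1.add hg.1, hf.2.add hg.2⟩)
    (fun f hf => (hf.1.integrable_of_hasCompactSupport hf.2).1) (memLp_one_iff_integrable.2 hf) hε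
  obtain ⟨F, rfl⟩ := exists_boundedContinuousFunction_eq hgc hg
  rw [eLpNorm_one_eq_lintegral_enorm] at hgε
  exact ⟨F, hg, hgε⟩

end radon

end

end Hypergroup

namespace Hypergroup

noncomputable section

variable {K : Type*} [TopologicalSpace K] [MeasurableSpace K]

/-! ### Integration against an `L^1` function as a functional on `C^b(K)` -/

section pairing

variable {μ : Measure K} {u : K → ℂ}

lemma norm_integral_mul_bcf_le (hu : Integrable u μ) (g : K →ᵇ ℂ) :
    ‖∫ y, u y * g y ∂μ‖ ≤ (∫ y, ‖u y‖ ∂μ) * ‖g‖ := by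
  rw [← integral_mul_const]
  refine norm_integral_le_of_norm_le (hu.norm.mul_const _)
    (Filter.Eventually.of_forall fun y => ?_)
  rw [norm_mul]
  exact mul_le_mul_of_nonneg_left (g.norm_coe_le_norm y) (norm_nonneg _)

variable [BorelSpace K]

lemma integrable_mul_bcf (hu : Integrable u μ) (g : K →ᵇ ℂ) : Integrable (fun y => u y * g y) μ :=
  hu.mul_bdd (c := ‖g‖) g.continuous.aestronglyMeasurable
    (Filter.Eventually.of_forall g.norm_coe_le_norm)

/-- The functional `h ↦ ∫ u h dμ` on `C^b(K)`, for `u ∈ L^1(μ)`. -/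
def pairing (hu : Integrable u μ) : (K →ᵇ ℂ) →L[ℂ] ℂ :=
  LinearMap.mkContinuous
    { toFun := fun g => ∫ y, u y * g y ∂μ
      map_add' := fun g h => by
        simp only [BoundedContinuousFunction.add_apply, mul_add]
        exact integral_add (integrable_mul_bcf hu g) (integrable_mul_bcf hu h)
      map_smul' := fun c g => by
        simp only [BoundedContinuousFunction.smul_apply, smul_eq_mul, RingHom.id_apply,
          mul_left_comm _ c, integral_const_mul] }
    (∫ y, ‖u y‖ ∂μ) (norm_integral_mul_bcf_le hu)

lemma pairing_apply (hu : Integrable u μ) (g : K →ᵇ ℂ) :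
    pairing hu g = ∫ y, u y * g y ∂μ := rfl

end pairing

/-! ### Translation on `L^1(K)` and invariance under the involution -/

section integrable

variable [BorelSpace K]

/-- The translation `T_x u (y) = ∫ u dω(x, y)` of a function on `K`. -/
def translateFun [Hypergroup K] (x : K) (u : K → ℂ) (y : K) : ℂ :=
  ∫ t, u t ∂(conv x y : Measure K)

lemma translateFun_coe [Hypergroup K] (x : K) (f : K →ᵇ ℂ) :
    translateFun x f = translate x f := rfl

variable [T2Space K] [LocallyCompactSpace K]

section noncomm

variable [Hypergroup K] (μ : Measure K) [IsHaar μ]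

/-- The mass of `B` is nearly attained by integrating over a compact `D`. For `y ∈ D` all `ω(x, y)`
live on one relatively compact `W`, so this part is absolutely continuous with respect to the finite
measure `μ.restrict W` and hence inner regular. -/
lemma innerRegular_bind_convKernel (x : K) : (μ.bind (convKernel x)).InnerRegular := by
  have hm : ∀ ν : Measure K, AEMeasurable (convKernel x) ν := fun ν =>
    (convKernel x).measurable.aemeasurable
  refine ⟨fun B hB r hr => ?_⟩
  rw [Measure.bind_apply hB (hm _), lintegral_eq_iSup_compacts μ
    ((convKernel x).measurable_coe hB).aemeasurable, lt_iSup_iff] at hr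
  obtain ⟨D, hr⟩ := hr
  obtain ⟨W, hW, hWc, hsub⟩ := exists_isOpen_support_subset x D.isCompact
  have hWfin : μ W ≠ ∞ := ((measure_mono subset_closure).trans_lt hWc.measure_lt_top).ne
  have : IsFiniteMeasure (μ.restrict W) := ⟨by simpa using hWfin.lt_top⟩
  rw [← Measure.bind_apply hB (hm _)] at hr
  have hac : (μ.restrict D).bind (convKernel x) ≪ μ.restrict W := by
    refine Measure.AbsolutelyContinuous.mk fun N hN h0 => ?_
    rw [Measure.restrict_apply hN] at h0
    rw [Measure.bind_apply hN (hm _)]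
    refine lintegral_eq_zero_of_ae_eq_zero ?_
    have h1 := ae_restrict_of_ae (s := (D : Set K))
      (ae_conv_eq_zero μ x (hN.inter hW.measurableSet) h0)
    filter_upwards [h1, ae_restrict_mem D.isCompact.measurableSet] with y hy hyD
    refine measure_mono_null (t := (N ∩ W) ∪ (conv x y : Measure K).supportᶜ) (fun t ht => ?_)
      (measure_union_null hy (support_mem_ae_conv x y))
    by_cases h : t ∈ (conv x y : Measure K).support
    · exact Or.inl ⟨ht, hsub y hyD h⟩
    · exact Or.inr h
  have hreg := innerRegular_of_absolutelyContinuous hac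
  obtain ⟨C, hCB, hC, hrC⟩ := hreg.innerRegular hB r hr
  refine ⟨C, hCB, hC, hrC.trans_le ?_⟩
  rw [Measure.bind_apply hC.measurableSet (hm _), Measure.bind_apply hC.measurableSet (hm _)]
  exact setLIntegral_le_lintegral _ _

/-- Invariance on `C_c(K)` becomes a comparison of measures by regularity. This inequality is all
that the contraction estimates need. -/
lemma bind_convKernel_le (x : K) : μ.bind (convKernel x) ≤ μ := by
  have := innerRegular_bind_convKernel μ x
  refine measure_le_of_lintegral_le fun f hf hfc => le_of_eq ?_
  rw [Measure.lintegral_bind (convKernel x).measurable.aemeasurable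
    hf.measurable.coe_nnreal_ennreal.aemeasurable]
  exact IsHaar.lintegral_translate x f hf hfc

/-- Translations are contractions with respect to the Haar measure. -/
lemma lintegral_lintegral_conv_le (x : K) {h : K → ℝ≥0∞} (hh : AEMeasurable h μ) :
    ∫⁻ y, ∫⁻ t, h t ∂(conv x y : Measure K) ∂μ ≤ ∫⁻ t, h t ∂μ := by
  refine le_trans (le_of_eq ?_) (lintegral_mono' (bind_convKernel_le μ x) le_rfl)
  exact (Measure.lintegral_bind (convKernel x).measurable.aemeasurable
    (hh.mono_measure (bind_convKernel_le μ x))).symm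

variable {μ}

lemma translateFun_congr {u v : K → ℂ} (h : u =ᵐ[μ] v) (x : K) :
    translateFun x u =ᵐ[μ] translateFun x v := by
  filter_upwards [ae_conv_of_ae μ x h] with y hy
  exact integral_congr_ae hy

lemma aestronglyMeasurable_translateFun {u : K → ℂ} (hu : AEStronglyMeasurable u μ) (x : K) :
    AEStronglyMeasurable (translateFun x u) μ :=
  ((hu.stronglyMeasurable_mk.integral_kernel (κ := convKernel x)).aestronglyMeasurable).congr
    (translateFun_congr hu.ae_eq_mk.symm x)

lemma lintegral_enorm_translateFun_le {u : K → ℂ} (hu : AEStronglyMeasurable u μ) (x : K) :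
    ∫⁻ y, ‖translateFun x u y‖ₑ ∂μ ≤ ∫⁻ t, ‖u t‖ₑ ∂μ :=
  (lintegral_mono fun _ => enorm_integral_le_lintegral_enorm _).trans
    (lintegral_lintegral_conv_le μ x hu.enorm)

lemma integrable_translateFun {u : K → ℂ} (hu : Integrable u μ) (x : K) :
    Integrable (translateFun x u) μ :=
  ⟨aestronglyMeasurable_translateFun hu.1 x,
    (lintegral_enorm_translateFun_le hu.1 x).trans_lt hu.2⟩

lemma integral_norm_translateFun_le {u : K → ℂ} (hu : Integrable u μ) (x : K) :
    ∫ y, ‖translateFun x u y‖ ∂μ ≤ ∫ t, ‖u t‖ ∂μ := by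
  rw [integral_norm_eq_lintegral_enorm (integrable_translateFun hu x).1,
    integral_norm_eq_lintegral_enorm hu.1]
  exact ENNReal.toReal_mono hu.2.ne (lintegral_enorm_translateFun_le hu.1 x)

/-- Where `u` is not `ω(x, y)`-integrable, `translateFun x u y` has the default value `0` and
additivity can fail; the contraction estimate for `|u|` makes this a null set of `y`. -/
lemma ae_integrable_conv {u : K → ℂ} (hu : Integrable u μ) (x : K) :
    ∀ᵐ y ∂μ, Integrable u (conv x y : Measure K) := by
  have h1 : ∀ᵐ y ∂μ, ∫⁻ t, ‖hu.1.mk u t‖ₑ ∂(conv x y : Measure K) < ∞ := by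
    refine ae_lt_top ?_ (ne_top_of_le_ne_top ?_ (lintegral_lintegral_conv_le μ x
      hu.1.stronglyMeasurable_mk.enorm.aemeasurable))
    · exact hu.1.stronglyMeasurable_mk.enorm.lintegral_kernel (κ := convKernel x)
    · exact (hu.congr hu.1.ae_eq_mk).2.ne
  filter_upwards [h1, ae_conv_of_ae μ x hu.1.ae_eq_mk] with y hy hy'
  exact Integrable.congr ⟨hu.1.stronglyMeasurable_mk.aestronglyMeasurable, hy⟩
    (Filter.EventuallyEq.symm hy')

lemma translateFun_add {u v : K → ℂ} (hu : Integrable u μ) (hv : Integrable v μ) (x : K) :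
    translateFun x (fun t => u t + v t) =ᵐ[μ]
      fun y => translateFun x u y + translateFun x v y := by
  filter_upwards [ae_integrable_conv hu x, ae_integrable_conv hv x] with y h1 h2
  exact integral_add h1 h2

lemma translateFun_sub {u v : K → ℂ} (hu : Integrable u μ) (hv : Integrable v μ) (x : K) :
    translateFun x (fun t => u t - v t) =ᵐ[μ]
      fun y => translateFun x u y - translateFun x v y := by
  filter_upwards [ae_integrable_conv hu x, ae_integrable_conv hv x] with y h1 h2
  exact integral_sub h1 h2

/-- `C_c(K)` is dense in `L^1(μ)`. -/
lemma exists_hasCompactSupport_integral_sub_le {u : K → ℂ} (hu : Integrable u μ) {ε : ℝ}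
    (hε : 0 < ε) : ∃ g : K →ᵇ ℂ, HasCompactSupport g ∧ ∫ t, ‖u t - g t‖ ∂μ ≤ ε := by
  obtain ⟨g, hg, h⟩ := exists_hasCompactSupport_lintegral_sub_le hu
    (ENNReal.ofReal_pos.2 hε).ne'
  refine ⟨g, hg, ?_⟩
  rw [integral_norm_eq_lintegral_enorm (f := fun t => u t - g t)
    (hu.sub (integrable_of_cc μ hg)).1]
  exact ENNReal.toReal_le_of_le_ofReal hε.le h

end noncomm

variable [CommHypergroup K] (μ : Measure K) [IsHaar μ]

/-- The Haar measure is invariant under the involution. -/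
lemma measurePreserving_invol : MeasurePreserving (invol : K → K) μ μ := by
  refine ⟨continuous_invol.measurable, ?_⟩
  have hir : (μ.map (invol : K → K)).InnerRegular :=
    Measure.InnerRegular.map_of_continuous continuous_invol
  have hle : μ.map (invol : K → K) ≤ μ := by
    refine measure_le_of_lintegral_le fun f hf hfc => le_of_eq ?_
    rw [lintegral_map hf.measurable.coe_nnreal_ennreal continuous_invol.measurable]
    obtain ⟨F, hF⟩ := exists_boundedContinuousFunction_eq (f := fun t => ((f t : ℝ) : ℂ))
      (Complex.continuous_ofReal.comp (NNReal.continuous_coe.comp hf))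
      (hfc.comp_left (g := fun r : ℝ≥0 => ((r : ℝ) : ℂ)) (by simp))
    have hFn : ∀ t, ‖F t‖ₑ = (f t : ℝ≥0∞) := fun t => by
      simp only [hF, ← ofReal_norm, Complex.norm_real, NNReal.norm_eq, ENNReal.ofReal_coe_nnreal]
    have hFc : HasCompactSupport F := by
      rw [hF]
      exact hfc.comp_left (g := fun r : ℝ≥0 => ((r : ℝ) : ℂ)) (by simp)
    have hF0 : ∀ t, F t = (‖F t‖ : ℂ) := fun t => by simp [hF]
    have hrF0 : ∀ t, reflect F t = (‖reflect F t‖ : ℂ) := fun t => hF0 _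
    have key := integral_reflect_of_nonneg μ hFc hF0
    rw [integral_eq_of_nonneg hF0, integral_eq_of_nonneg hrF0, Complex.ofReal_inj] at key
    have h1 := congrArg ENNReal.ofReal key
    rw [ofReal_integral_norm_eq_lintegral_enorm (integrable_of_cc μ hFc),
      ofReal_integral_norm_eq_lintegral_enorm
        (integrable_of_cc μ (hasCompactSupport_reflect hFc))] at h1
    simpa only [reflect_apply, hFn] using h1
  -- Pushing `hle` forward under the involution yields the opposite inequality.
  refine le_antisymm hle ?_
  have h := Measure.map_mono hle (continuous_invol (K := K)).measurable
  rwa [Measure.map_map continuous_invol.measurable continuous_invol.measurable,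
    show (invol ∘ invol : K → K) = id from funext invol_invol, Measure.map_id] at h

variable {μ}

/-- The adjoint of `T_x` is `T_{x̃}`, on `L^1(μ)` and `C_c(K)`. -/
lemma integral_translateFun_mul {u : K → ℂ} (hu : Integrable u μ) {g : K →ᵇ ℂ}
    (hg : HasCompactSupport g) (x : K) :
    ∫ y, translateFun x u y * g y ∂μ = ∫ y, u y * translate (invol x) g y ∂μ := by
  refine sub_eq_zero.1 (norm_le_zero_iff.1 (le_of_forall_pos_le_add fun δ hδ => ?_))
  set ε := δ / (2 * ‖g‖ + 1)
  have hε : 0 < ε := by positivity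
  obtain ⟨f, hf, hfε⟩ := exists_hasCompactSupport_integral_sub_le hu hε
  have hfi := integrable_of_cc μ hf
  have hsub : Integrable (fun t => u t - f t) μ := hu.sub hfi
  have h1 : ∫ y, translateFun x u y * g y ∂μ - ∫ y, translate x f y * g y ∂μ =
      ∫ y, translateFun x (fun t => u t - f t) y * g y ∂μ := by
    rw [← translateFun_coe, ← integral_sub (integrable_mul_bcf (integrable_translateFun hu x) g)
      (integrable_mul_bcf (integrable_translateFun hfi x) g)]
    refine integral_congr_ae ?_
    filter_upwards [translateFun_sub hu hfi x] with y hy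
    rw [hy, sub_mul]
  have h2 : ∫ y, u y * translate (invol x) g y ∂μ - ∫ y, f y * translate (invol x) g y ∂μ =
      ∫ y, (u y - f y) * translate (invol x) g y ∂μ := by
    rw [← integral_sub (integrable_mul_bcf hu _) (integrable_mul_bcf hfi _)]
    simp only [sub_mul]
  have b1 : ‖∫ y, translateFun x (fun t => u t - f t) y * g y ∂μ‖ ≤ ε * ‖g‖ :=
    (norm_integral_mul_bcf_le (integrable_translateFun hsub x) g).trans (mul_le_mul_of_nonneg_right
      ((integral_norm_translateFun_le hsub x).trans hfε) (norm_nonneg _))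
  have b2 : ‖∫ y, (u y - f y) * translate (invol x) g y ∂μ‖ ≤ ε * ‖g‖ :=
    (norm_integral_mul_bcf_le hsub _).trans (mul_le_mul hfε (norm_translate_le _ _) (norm_nonneg _) hε.le)
  rw [← h1] at b1
  rw [← h2] at b2
  rw [integral_translate_mul μ hf hg] at b1
  have h3 := norm_sub_le _ _ |>.trans (add_le_add b1 b2)
  rw [sub_sub_sub_cancel_right] at h3
  have h4 : ε * ‖g‖ + ε * ‖g‖ ≤ δ := by
    have : ε * (2 * ‖g‖ + 1) = δ := div_mul_cancel₀ _ (by positivity)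
    nlinarith
  linarith

/-- The adjoint of `T_x` is `T_{x̃}`, on `L^∞(μ)` and `C_c(K)`. -/
lemma integral_translateFun_mul_of_memLp_top {φ : K → ℂ} (hφ : MemLp φ ∞ μ) {g : K →ᵇ ℂ}
    (hg : HasCompactSupport g) (x : K) :
    ∫ y, translateFun x φ y * g y ∂μ = ∫ y, φ y * translate (invol x) g y ∂μ := by
  obtain ⟨W₁, hW₁, h₁⟩ := exists_isCompact_support_subset (isCompact_singleton (x := x)) hg.isCompact
  -- Large enough that cutting `φ` off outside `W` changes neither side, while the cut-off function
  -- is in `L^1`.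
  set W := W₁ ∪ tsupport (translate (invol x) g)
  have hW : IsCompact W := hW₁.union (hasCompactSupport_translate hg (invol x)).isCompact
  have : Fact (μ W < ∞) := ⟨hW.measure_lt_top⟩
  have hu : Integrable (W.indicator φ) μ :=
    (integrable_indicator_iff hW.measurableSet).2 ((hφ.restrict W).integrable le_top)
  have key := integral_translateFun_mul hu hg x
  convert key using 1
  · refine integral_congr_ae (Filter.Eventually.of_forall fun y => ?_)
    by_cases hy : y ∈ tsupport g
    · simp only
      congr 1
      refine integral_congr_ae ?_
      filter_upwards [support_mem_ae_conv x y] with t ht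
      have htW : t ∈ W := Or.inl (h₁ x rfl y hy ht)
      rw [Set.indicator_of_mem htW]
    · simp [image_eq_zero_of_notMem_tsupport hy]
  · refine integral_congr_ae (Filter.Eventually.of_forall fun y => ?_)
    by_cases hy : y ∈ W
    · simp [hy]
    · have hy' : translate (invol x) g y = 0 :=
        image_eq_zero_of_notMem_tsupport fun h => hy (Or.inr h)
      simp [hy']

end integrable

end

end Hypergroup

namespace Hypergroup

noncomputable section

variable {K : Type*} [TopologicalSpace K] [MeasurableSpace K] [BorelSpace K]

/-! ### The convolution of `L^∞(K)` with `L^1(K)` -/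

section convolution

lemma ae_norm_le_norm {X : Type*} [MeasurableSpace X] {μ : Measure X} (φ : Lp ℂ ∞ μ) : ∀ᵐ t ∂μ, ‖φ t‖ ≤ ‖φ‖ := by
  have h := ae_le_eLpNormEssSup (f := φ) (μ := μ)
  rw [← eLpNorm_exponent_top, ← Lp.enorm_def] at h
  filter_upwards [h] with t ht using by simpa [enorm_le_iff_norm_le] using ht

variable [CommHypergroup K]

/-- The convolution of two functions on `K`. -/
def convFun (μ : Measure K) (φ u : K → ℂ) (z : K) : ℂ :=
  ∫ y, φ y * translateFun z u (invol y) ∂μ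

/-- By commutativity `T_{ỹ} g(z) = T_z g(ỹ)`: for fixed `z` only one translate of `g` occurs, and
the `L^1` estimates apply. -/
lemma convolution_eq_convFun (μ : Measure K) (φ : Lp ℂ ∞ μ) (g : Lp ℂ 1 μ) (z : K) :
    convolution μ φ g z = convFun μ φ g z := by
  simp only [convolution, convFun, translateFun, CommHypergroup.conv_comm z]

lemma convFun_coe (μ : Measure K) (φ : K → ℂ) (f : K →ᵇ ℂ) (z : K) :
    convFun μ φ f z = ∫ y, φ y * translate (invol z) (reflect f) y ∂μ := by
  simp only [convFun, translateFun_coe, translate_reflect, reflect_apply, invol_invol]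

lemma convFun_smul_right (μ : Measure K) (φ u : K → ℂ) (c : ℂ) (z : K) :
    convFun μ φ (fun t => c * u t) z = c * convFun μ φ u z := by
  simp only [convFun, translateFun, integral_const_mul, mul_left_comm _ c]

lemma convFun_smul_left {μ : Measure K} (φ : Lp ℂ ∞ μ) (u : K → ℂ) (c : ℂ) (z : K) :
    convFun μ (c • φ : Lp ℂ ∞ μ) u z = c * convFun μ φ u z := by
  rw [convFun, convFun, ← integral_const_mul]
  refine integral_congr_ae ?_
  filter_upwards [Lp.coeFn_smul c φ] with y h
  rw [h, Pi.smul_apply, smul_eq_mul, mul_assoc]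

variable [T2Space K] [LocallyCompactSpace K] {μ : Measure K} [IsHaar μ]

lemma ae_invol {p : K → Prop} (h : ∀ᵐ y ∂μ, p y) : ∀ᵐ y ∂μ, p (invol y) :=
  (measurePreserving_invol μ).quasiMeasurePreserving.ae h

lemma integrable_translateFun_invol {u : K → ℂ} (hu : Integrable u μ) (z : K) :
    Integrable (fun y => translateFun z u (invol y)) μ :=
  (measurePreserving_invol μ).integrable_comp_of_integrable (integrable_translateFun hu z)

lemma integral_comp_invol (f : K → ℝ) : ∫ y, f (invol y) ∂μ = ∫ y, f y ∂μ :=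
  (measurePreserving_invol μ).integral_comp (involHomeomorph K).measurableEmbedding f

lemma integrable_convFun (φ : Lp ℂ ∞ μ) {u : K → ℂ} (hu : Integrable u μ) (z : K) :
    Integrable (fun y => φ y * translateFun z u (invol y)) μ :=
  (integrable_translateFun_invol hu z).bdd_mul (c := ‖φ‖) (Lp.aestronglyMeasurable φ)
    (ae_norm_le_norm φ)

/-- Holds at every `z`, not just almost everywhere, so `L^1` approximation of `u` gives uniform
approximation of the convolution. -/
lemma norm_convFun_le (φ : Lp ℂ ∞ μ) {u : K → ℂ} (hu : Integrable u μ) (z : K) :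
    ‖convFun μ φ u z‖ ≤ ‖φ‖ * ∫ y, ‖u y‖ ∂μ := by
  calc ‖convFun μ φ u z‖ ≤ ∫ y, ‖φ‖ * ‖translateFun z u (invol y)‖ ∂μ := by
        refine norm_integral_le_of_norm_le ((integrable_translateFun_invol hu z).norm.const_mul _) ?_
        filter_upwards [ae_norm_le_norm φ] with y hy
        rw [norm_mul]
        exact mul_le_mul_of_nonneg_right hy (norm_nonneg _)
    _ = ‖φ‖ * ∫ y, ‖translateFun z u y‖ ∂μ := by
        rw [integral_const_mul, integral_comp_invol (fun y => ‖translateFun z u y‖)]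
    _ ≤ ‖φ‖ * ∫ y, ‖u y‖ ∂μ := by
        exact mul_le_mul_of_nonneg_left (integral_norm_translateFun_le hu z) (norm_nonneg _)

lemma convFun_congr {φ ψ u v : K → ℂ} (h : φ =ᵐ[μ] ψ) (h' : u =ᵐ[μ] v) (z : K) :
    convFun μ φ u z = convFun μ ψ v z := by
  refine integral_congr_ae ?_
  filter_upwards [h, ae_invol (translateFun_congr h' z)] with y h1 h2
  rw [h1, h2]

lemma convFun_add_right (φ : Lp ℂ ∞ μ) {u v : K → ℂ} (hu : Integrable u μ) (hv : Integrable v μ)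
    (z : K) : convFun μ φ (fun t => u t + v t) z = convFun μ φ u z + convFun μ φ v z := by
  rw [convFun, convFun, convFun, ← integral_add (integrable_convFun φ hu z)
    (integrable_convFun φ hv z)]
  refine integral_congr_ae ?_
  filter_upwards [ae_invol (translateFun_add hu hv z)] with y h
  rw [h, mul_add]

lemma convFun_sub_right (φ : Lp ℂ ∞ μ) {u v : K → ℂ} (hu : Integrable u μ) (hv : Integrable v μ)
    (z : K) : convFun μ φ (fun t => u t - v t) z = convFun μ φ u z - convFun μ φ v z := by
  rw [convFun, convFun, convFun, ← integral_sub (integrable_convFun φ hu z)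
    (integrable_convFun φ hv z)]
  refine integral_congr_ae ?_
  filter_upwards [ae_invol (translateFun_sub hu hv z)] with y h
  rw [h, mul_sub]

lemma convFun_add_left (φ ψ : Lp ℂ ∞ μ) {u : K → ℂ} (hu : Integrable u μ) (z : K) :
    convFun μ (φ + ψ : Lp ℂ ∞ μ) u z = convFun μ φ u z + convFun μ ψ u z := by
  rw [convFun, convFun, convFun, ← integral_add (integrable_convFun φ hu z)
    (integrable_convFun ψ hu z)]
  refine integral_congr_ae ?_
  filter_upwards [Lp.coeFn_add φ ψ] with y h
  rw [h, Pi.add_apply, add_mul]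

/-- `x ↦ T_x f` is continuous from `K` to `L^1(μ)`, for `f ∈ C_c(K)`. -/
lemma tendsto_integral_norm_translate_sub {f : K →ᵇ ℂ} (hf : HasCompactSupport f) (x₀ : K) :
    Filter.Tendsto (fun x => ∫ y, ‖translate x f y - translate x₀ f y‖ ∂μ) (𝓝 x₀) (𝓝 0) := by
  obtain ⟨A, hA, hxA⟩ := exists_compact_mem_nhds x₀
  obtain ⟨W, hW, h⟩ := exists_isCompact_translate_eq_zero hf hA
  have hlim : Filter.Tendsto (fun x => ‖translate x f - translate x₀ f‖ * μ.real W) (𝓝 x₀)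
      (𝓝 0) := by
    have h1 : Continuous fun x => translate x f := mem_UC_of_hasCompactSupport hf
    have h2 : Continuous fun x => ‖translate x f - translate x₀ f‖ * μ.real W :=
      (h1.sub continuous_const).norm.mul continuous_const
    exact h2.tendsto' x₀ 0 (by simp)
  refine squeeze_zero' (Filter.Eventually.of_forall fun x => integral_nonneg fun _ => norm_nonneg _)
    ?_ hlim
  filter_upwards [hxA] with x hx
  have hW' : ∀ y ∉ W, ‖translate x f y - translate x₀ f y‖ = 0 := fun y hy => by
    rw [h x hx y hy, h x₀ (mem_of_mem_nhds hxA) y hy, sub_zero, norm_zero]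
  rw [← setIntegral_eq_integral_of_forall_compl_eq_zero hW']
  have := norm_setIntegral_le_of_norm_le_const (μ := μ) (s := W) hW.measure_lt_top
    (f := fun y => ‖translate x f y - translate x₀ f y‖)
    (C := ‖translate x f - translate x₀ f‖) fun y _ => by
      rw [norm_norm]
      exact (translate x f - translate x₀ f).norm_coe_le_norm y
  exact (le_abs_self _).trans this

/-- For `u ∈ C_c(K)` this is the `L^1`-continuity of the translates of `reflect u`; a general `u`
gives a uniform limit of such convolutions. -/
lemma continuous_convFun (φ : Lp ℂ ∞ μ) {u : K → ℂ} (hu : Integrable u μ) :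
    Continuous (convFun μ φ u) := by
  have hcc : ∀ f : K →ᵇ ℂ, HasCompactSupport f → Continuous (convFun μ φ f) := by
    intro f hf
    have hr := hasCompactSupport_reflect hf
    refine continuous_iff_continuousAt.2 fun z₀ => ?_
    have hlim := ((tendsto_integral_norm_translate_sub (μ := μ) hr (invol z₀)).comp
      (continuous_invol.tendsto z₀)).const_mul ‖φ‖
    rw [mul_zero] at hlim
    refine tendsto_iff_norm_sub_tendsto_zero.2 (squeeze_zero (fun _ => norm_nonneg _)
      (fun z => ?_) hlim)
    have hi : ∀ z, Integrable (fun y => φ y * translate (invol z) (reflect f) y) μ := fun z =>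
      (integrable_of_cc μ (hasCompactSupport_translate hr _)).bdd_mul (c := ‖φ‖)
        (Lp.aestronglyMeasurable φ) (ae_norm_le_norm φ)
    rw [convFun_coe, convFun_coe, ← integral_sub (hi z) (hi z₀)]
    simp only [Function.comp, ← mul_sub]
    rw [← integral_const_mul]
    refine norm_integral_le_of_norm_le (((integrable_of_cc μ (hasCompactSupport_translate hr _)).sub
      (integrable_of_cc μ (hasCompactSupport_translate hr _))).norm.const_mul _) ?_
    filter_upwards [ae_norm_le_norm φ] with y hy
    rw [norm_mul]
    exact mul_le_mul_of_nonneg_right hy (norm_nonneg _)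
  refine continuous_of_uniform_approx_of_continuous fun s hs => ?_
  obtain ⟨ε, hε, hεs⟩ := Metric.mem_uniformity_dist.1 hs
  obtain ⟨f, hf, hfε⟩ := exists_hasCompactSupport_integral_sub_le hu
    (show 0 < ε / (‖φ‖ + 1) by positivity)
  refine ⟨convFun μ φ f, hcc f hf, fun z => hεs ?_⟩
  have hfi := integrable_of_cc μ hf
  rw [dist_eq_norm, ← convFun_sub_right φ hu hfi]
  refine (norm_convFun_le φ (hu.sub hfi) z).trans_lt ?_
  calc ‖φ‖ * ∫ y, ‖u y - f y‖ ∂μ ≤ ‖φ‖ * (ε / (‖φ‖ + 1)) := by gcongr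
    _ < (‖φ‖ + 1) * (ε / (‖φ‖ + 1)) := by
        have : 0 < ε / (‖φ‖ + 1) := by positivity
        gcongr
        linarith
    _ = ε := by field_simp

variable (μ) in
/-- The convolution as a bounded bilinear map `L^∞(K) × L^1(K) → C^b(K)`. -/
def convL : Lp ℂ ∞ μ →L[ℂ] Lp ℂ 1 μ →L[ℂ] (K →ᵇ ℂ) :=
  LinearMap.mkContinuous₂
    (LinearMap.mk₂ ℂ
      (fun φ g => BoundedContinuousFunction.ofNormedAddCommGroup (convFun μ φ g)
        (continuous_convFun φ (L1.integrable_coeFn g)) (‖φ‖ * ∫ y, ‖g y‖ ∂μ)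
        (norm_convFun_le φ (L1.integrable_coeFn g)))
      (fun φ ψ g => by
        ext z
        exact convFun_add_left φ ψ (L1.integrable_coeFn g) z)
      (fun c φ g => by
        ext z
        exact convFun_smul_left φ g c z)
      (fun φ g h => by
        ext z
        exact (convFun_congr (Filter.EventuallyEq.refl _ _) (Lp.coeFn_add g h) z).trans
          (convFun_add_right φ (L1.integrable_coeFn g) (L1.integrable_coeFn h) z))
      (fun c φ g => by
        ext z
        exact (convFun_congr (Filter.EventuallyEq.refl _ _) (Lp.coeFn_smul c g) z).trans
          (convFun_smul_right μ φ g c z)))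
    1 fun φ g => by
      rw [one_mul, L1.norm_eq_integral_norm]
      exact BoundedContinuousFunction.norm_ofNormedAddCommGroup_le _
        (mul_nonneg (norm_nonneg _) (integral_nonneg fun _ => norm_nonneg _))
        (norm_convFun_le φ (L1.integrable_coeFn g))

lemma convL_apply (φ : Lp ℂ ∞ μ) (g : Lp ℂ 1 μ) (z : K) : convL μ φ g z = convFun μ φ g z := rfl

end convolution

/-! ### `φ * g ∈ UC(K)` and the transfer of means -/

section means

lemma isClosed_UC [Hypergroup K] : IsClosed (UC K : Set (K →ᵇ ℂ)) := by
  refine isClosed_of_closure_subset fun f hf => ?_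
  refine continuous_of_uniform_approx_of_continuous fun s hs => ?_
  obtain ⟨ε, hε, hεs⟩ := Metric.mem_uniformity_dist.1 hs
  obtain ⟨g, hg, hfg⟩ := Metric.mem_closure_iff.1 hf ε hε
  refine ⟨fun x => translate x g, hg, fun x => hεs (lt_of_le_of_lt ?_ hfg)⟩
  change dist (translateL x f) (translateL x g) ≤ dist f g
  rw [dist_eq_norm, dist_eq_norm, ← map_sub]
  exact norm_translate_le x _

/-- Needed for Bochner integrals with values in `UC(K)`, under which a mean defined only on `UC(K)`
can be applied. -/
instance [Hypergroup K] : CompleteSpace (UC K) := isClosed_UC.completeSpace_coe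

lemma toLinfty_coeFn (μ : Measure K) (f : K →ᵇ ℂ) : toLinfty μ f =ᵐ[μ] f := MemLp.coeFn_toLp _

lemma memLp_top_bcf (μ : Measure K) (f : K →ᵇ ℂ) : MemLp f ∞ μ :=
  memLp_top_of_bound f.continuous.aestronglyMeasurable ‖f‖
    (Filter.Eventually.of_forall f.norm_coe_le_norm)

/-- The embedding of `C^b(K)` into `L^∞(K)` as a continuous linear map. -/
def toLinftyL (μ : Measure K) : (K →ᵇ ℂ) →L[ℂ] Lp ℂ ∞ μ :=
  LinearMap.mkContinuous
    { toFun := toLinfty μ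
      map_add' := fun _ _ => rfl
      map_smul' := fun _ _ => rfl } 1 fun f => by
    rw [one_mul]
    change ‖toLinfty μ f‖ ≤ ‖f‖
    rw [toLinfty, Lp.norm_toLp, eLpNorm_exponent_top]
    exact ENNReal.toReal_le_of_le_ofReal (norm_nonneg f)
      (eLpNormEssSup_le_of_ae_bound (Filter.Eventually.of_forall f.norm_coe_le_norm))

variable [T2Space K] [LocallyCompactSpace K]

lemma toLinfty_translate [Hypergroup K] (μ : Measure K) [IsHaar μ] (x : K) (f : K →ᵇ ℂ) :
    toLinfty μ (translate x f) = translateLinfty μ x (toLinfty μ f) := by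
  refine Lp.ext ((toLinfty_coeFn μ _).trans ?_)
  exact (translateLinfty_toLp μ x (memLp_top_bcf μ f)).symm

/-- To prove a closed property of elements of `L^1(K)`, it suffices to consider `C_c(K)`. -/
lemma l1_induction [Hypergroup K] {μ : Measure K} [IsHaar μ] {p : Lp ℂ 1 μ → Prop}
    (hp : IsClosed {g | p g})
    (h : ∀ (f : K →ᵇ ℂ) (hf : HasCompactSupport f), p ((integrable_of_cc μ hf).toL1 f))
    (g : Lp ℂ 1 μ) : p g := by
  refine hp.closure_subset_iff.2 (Set.Subset.refl _) (Metric.mem_closure_iff.2 fun ε hε => ?_)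
  obtain ⟨f, hf, hfε⟩ := exists_hasCompactSupport_integral_sub_le (L1.integrable_coeFn g)
    (half_pos hε)
  refine ⟨_, h f hf, lt_of_le_of_lt ?_ (half_lt_self hε)⟩
  rw [L1.dist_eq_integral_dist]
  refine le_trans (le_of_eq (integral_congr_ae ?_)) hfε
  filter_upwards [(integrable_of_cc μ hf).coeFn_toL1] with t ht
  rw [ht, dist_eq_norm]

variable [CommHypergroup K] {μ : Measure K} [IsHaar μ]

lemma convL_toL1 (φ : Lp ℂ ∞ μ) {f : K →ᵇ ℂ} (hf : HasCompactSupport f) (z : K) :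
    convL μ φ ((integrable_of_cc μ hf).toL1 f) z =
      ∫ y, φ y * translate (invol z) (reflect f) y ∂μ := by
  rw [← convFun_coe, convL_apply]
  exact convFun_congr (Filter.EventuallyEq.refl _ _) (Integrable.coeFn_toL1 _) z

/-- `T_x (φ * f) = φ * T_x f` for `φ ∈ L^∞(K)` and `f ∈ C_c(K)`. -/
lemma translate_convL_toL1 (φ : Lp ℂ ∞ μ) {f : K →ᵇ ℂ} (hf : HasCompactSupport f) (x : K) :
    translate x (convL μ φ ((integrable_of_cc μ hf).toL1 f)) =
      convL μ φ ((integrable_of_cc μ (hasCompactSupport_translate hf x)).toL1 (translate x f)) := by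
  ext z
  have hr := hasCompactSupport_reflect hf
  set C := (conv x z : Measure K).support
  have hC : IsCompact C := isCompact_support x z
  obtain ⟨W, hW, hW0⟩ := exists_isCompact_translate_eq_zero hr (hC.image continuous_invol)
  have hW0' : ∀ t ∈ C, ∀ y ∉ W, translate (invol t) (reflect f) y = 0 := fun t ht y hy =>
    hW0 _ (Set.mem_image_of_mem _ ht) y hy
  have : Fact (μ W < ∞) := ⟨hW.measure_lt_top⟩
  have hw : Integrable (W.indicator φ) μ :=
    (integrable_indicator_iff hW.measurableSet).2 (((Lp.memLp φ).restrict W).integrable le_top)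
  -- The integrals over `ω(x, z)` and `μ` are exchanged by applying the bounded functional `pairing
  -- hw` to the Bochner integral `B` of `G`. All functions involved vanish off `W`, so `φ` may be
  -- cut off there.
  let G : K → K →ᵇ ℂ := fun t => translate (invol t) (reflect f)
  have hG : Continuous G :=
    (show Continuous fun x => translate x (reflect f) from
      mem_UC_of_hasCompactSupport hr).comp continuous_invol
  have hGi : Integrable G (conv x z : Measure K) := by
    refine Integrable.of_bound (C := ‖reflect f‖) ?_
      (Filter.Eventually.of_forall fun t => norm_translate_le _ _)
    -- Strong measurability needs a separable range, which is available on the compact support of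
    -- `ω(x, z)`.
    have h := hG.continuousOn.aestronglyMeasurable_of_isCompact (μ := (conv x z : Measure K)) hC
      hC.measurableSet
    rwa [Measure.restrict_eq_self_of_ae_mem (support_mem_ae_conv x z)] at h
  set B : K →ᵇ ℂ := ∫ t, G t ∂(conv x z : Measure K)
  have hB : ∀ y, B y = ∫ t, G t y ∂(conv x z : Measure K) := fun y =>
    ((BoundedContinuousFunction.evalCLM ℂ y).integral_comp_comm hGi).symm
  have hBz : ∀ y, B y = translate (invol z) (reflect (translate x f)) y := by
    intro y
    rw [hB, ← translate_invol_apply, translate_comm]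
    refine integral_congr_ae (Filter.Eventually.of_forall fun t => ?_)
    exact (translate_invol_apply y t f).symm
  have hB0 : ∀ y ∉ W, B y = 0 := by
    intro y hy
    rw [hB]
    refine integral_eq_zero_of_ae ?_
    filter_upwards [support_mem_ae_conv x z] with t ht using hW0' t ht y hy
  have hind : ∀ h : K →ᵇ ℂ, (∀ y ∉ W, h y = 0) → pairing hw h = ∫ y, φ y * h y ∂μ := by
    intro h h0
    rw [pairing_apply]
    refine integral_congr_ae (Filter.Eventually.of_forall fun y => ?_)
    by_cases hy : y ∈ W
    · simp [hy]
    · simp [h0 y hy]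
  calc translate x (convL μ φ ((integrable_of_cc μ hf).toL1 f)) z
      = ∫ t, pairing hw (G t) ∂(conv x z : Measure K) := by
        refine integral_congr_ae ?_
        filter_upwards [support_mem_ae_conv x z] with t ht
        rw [hind _ (hW0' t ht), convL_toL1 φ hf]
    _ = pairing hw B := (pairing hw).integral_comp_comm hGi
    _ = _ := by
        rw [hind B hB0, convL_toL1 φ (hasCompactSupport_translate hf x)]
        simp only [hBz]

/-- `φ * g ∈ UC(K)` for `φ ∈ L^∞(K)` and `g ∈ L^1(K)`. -/
lemma convL_mem_UC (φ : Lp ℂ ∞ μ) (g : Lp ℂ 1 μ) : convL μ φ g ∈ UC K := by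
  refine l1_induction (p := fun g => convL μ φ g ∈ UC K)
    (isClosed_UC.preimage (convL μ φ).continuous) (fun f hf => ?_) g
  change Continuous fun x => translate x (convL μ φ ((integrable_of_cc μ hf).toL1 f))
  simp only [translate_convL_toL1 φ hf]
  refine (convL μ φ).continuous.comp (continuous_iff_continuousAt.2 fun x₀ => ?_)
  refine tendsto_iff_norm_sub_tendsto_zero.2 ?_
  refine (tendsto_integral_norm_translate_sub (μ := μ) hf x₀).congr fun x => ?_
  rw [← Integrable.toL1_sub, L1.norm_of_fun_eq_integral_norm]
  rfl

/-- `(T_x φ) * g = T_x (φ * g)`. -/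
lemma convL_translateLinfty (φ : Lp ℂ ∞ μ) (g : Lp ℂ 1 μ) (x : K) :
    convL μ (translateLinfty μ x φ) g = translate x (convL μ φ g) := by
  refine l1_induction (p := fun g => convL μ (translateLinfty μ x φ) g =
    translateL x (convL μ φ g)) (isClosed_eq (convL μ _).continuous
      ((translateL x).continuous.comp (convL μ φ).continuous)) (fun f hf => ?_) g
  rw [translateL_apply, translate_convL_toL1 φ hf]
  ext z
  have hr := hasCompactSupport_reflect hf
  -- Reflection turns `T_x` into `T_{x̃}`, which the adjoint relation then moves onto `φ` as `T_x`.
  have h : translate (invol z) (reflect (translate x f)) =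
      translate (invol x) (translate (invol z) (reflect f)) := by
    rw [translate_comm, translate_reflect (invol x), invol_invol]
  rw [convL_toL1 _ hf, convL_toL1 _ (hasCompactSupport_translate hf x), h,
    ← integral_translateFun_mul_of_memLp_top (Lp.memLp φ) (hasCompactSupport_translate hr _)]
  refine integral_congr_ae ?_
  filter_upwards [(memLp_translate μ x φ).coeFn_toLp] with y hy
  exact congrArg (· * _) hy

/-- `f * g = ∫ g(s) T_{s̃} f dμ(s)` for `f ∈ C^b(K)` and `g ∈ C_c(K)`. -/
lemma convL_toLinfty {f g : K →ᵇ ℂ} (hf : f ∈ UC K) (hg : HasCompactSupport g) :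
    convL μ (toLinfty μ f) ((integrable_of_cc μ hg).toL1 g) = smear μ g f := by
  ext z
  have hr := hasCompactSupport_reflect hg
  rw [convL_toL1 _ hg, smear_apply μ hg hf]
  calc ∫ y, toLinfty μ f y * translate (invol z) (reflect g) y ∂μ
      = ∫ y, f y * translate (invol z) (reflect g) y ∂μ := by
        refine integral_congr_ae ?_
        filter_upwards [toLinfty_coeFn μ f] with y hy
        rw [hy]
    _ = ∫ y, translate z f y * reflect g y ∂μ :=
        (integral_translateFun_mul_of_memLp_top (memLp_top_bcf μ f) hr z).symm
    _ = ∫ y, translate z f (invol y) * reflect g (invol y) ∂μ :=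
        ((measurePreserving_invol μ).integral_comp (involHomeomorph K).measurableEmbedding _).symm
    _ = ∫ s, g s * translate (invol s) f z ∂μ := by
        refine integral_congr_ae (Filter.Eventually.of_forall fun s => ?_)
        simp only [reflect_apply, invol_invol, translate_apply_comm z, mul_comm]

/-- The Fourier transform of `g` at `α` is the value of `α * g` at the identity. -/
lemma fourier_eq_convL {α : K →ᵇ ℂ} (hα : α ∈ Dual K) (g : Lp ℂ 1 μ) :
    fourier μ g α = convL μ (toLinfty μ α) g one := by
  rw [convL_apply, convFun_congr (toLinfty_coeFn μ α) (Filter.EventuallyEq.refl _ _)]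
  have h1 : ∀ y, translateFun one g y = g y := fun y => by
    rw [translateFun, one_conv, integral_dirac]
  simp only [convFun, h1]
  refine ((measurePreserving_invol μ).integral_comp
    (involHomeomorph K).measurableEmbedding _).symm.trans ?_
  refine integral_congr_ae (Filter.Eventually.of_forall fun y => ?_)
  simp only [hα.2.2, Complex.conj_conj]

/-- The map `φ ↦ φ * g` from `L^∞(K)` to `UC(K)`. -/
def convUC (g : Lp ℂ 1 μ) : Lp ℂ ∞ μ →L[ℂ] UC K :=
  ((convL μ).flip g).codRestrict (UC K) fun φ => convL_mem_UC φ g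

lemma convUC_coe (g : Lp ℂ 1 μ) (φ : Lp ℂ ∞ μ) : (convUC g φ : K →ᵇ ℂ) = convL μ φ g := rfl

/-- `m(f * g) = ĝ(α) m(f)` for an `α`-mean `m` on `UC(K)` and `f ∈ UC(K)`. -/
lemma mean_convUC {α : K →ᵇ ℂ} (hα : α ∈ Dual K) {m : UC K →L[ℂ] ℂ} (hm : IsAlphaMeanUC hα m)
    (f : UC K) (g : Lp ℂ 1 μ) : m (convUC g (toLinfty μ f.1)) = fourier μ g α * m f := by
  have hcont : Continuous fun g : Lp ℂ 1 μ => convUC g (toLinfty μ f.1) :=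
    (convL μ (toLinfty μ f.1)).continuous.subtype_mk _
  have hfour : Continuous fun g : Lp ℂ 1 μ => fourier μ g α := by
    simp only [fourier_eq_convL hα]
    exact (BoundedContinuousFunction.evalCLM ℂ (one : K)).continuous.comp
      (convL μ (toLinfty μ α)).continuous
  refine l1_induction (p := fun g => m (convUC g (toLinfty μ f.1)) = fourier μ g α * m f)
    (isClosed_eq (m.continuous.comp hcont) (hfour.mul continuous_const)) (fun g hg => ?_) g
  -- The integral is formed in `UC(K)` rather than in `C^b(K)`, since `m` is defined only there.
  have hint : Integrable (fun s => g s • translateUC (invol s) f) μ := by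
    refine Continuous.integrable_of_hasCompactSupport ?_ ?_
    · refine g.continuous.smul (Continuous.subtype_mk ?_ _)
      exact (show Continuous fun x => translate x f.1 from f.2).comp continuous_invol
    · refine HasCompactSupport.intro hg.isCompact fun s hs => ?_
      rw [image_eq_zero_of_notMem_tsupport hs, zero_smul]
  have heq : convUC ((integrable_of_cc μ hg).toL1 g) (toLinfty μ f.1) =
      ∫ s, g s • translateUC (invol s) f ∂μ := by
    refine Subtype.ext ?_
    rw [convUC_coe, convL_toLinfty f.2 hg]
    exact (UC K).subtypeL.integral_comp_comm hint
  rw [heq, ← m.integral_comp_comm hint]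
  simp only [map_smul, hm.map_translate, smul_eq_mul, hα.2.2, ← mul_assoc, integral_mul_const]
  congr 1
  refine integral_congr_ae ?_
  filter_upwards [(integrable_of_cc μ hg).coeFn_toL1] with s hs
  rw [hs, mul_comm]

lemma isAlphaMeanLinfty_convUC {α : K →ᵇ ℂ} (hα : α ∈ Dual K) {m : UC K →L[ℂ] ℂ}
    (hm : IsAlphaMeanUC hα m) {g : Lp ℂ 1 μ} (hg : fourier μ g α = 1) :
    IsAlphaMeanLinfty μ α (m ∘L convUC g) where
  map_char := by
    have := mean_convUC hα hm ⟨α, dual_subset_UC hα⟩ g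
    rwa [hg, one_mul, hm.map_char] at this
  map_translate x φ := by
    have h : convUC g (translateLinfty μ x φ) = translateUC x (convUC g φ) :=
      Subtype.ext (convL_translateLinfty φ g x)
    rw [ContinuousLinearMap.comp_apply, h, hm.map_translate]
    rfl

variable (μ) in
-- Multiplicativity gives `α one = 1`. With a bump `χ` at the identity, `α χ` has Fourier transform
-- `∫ |α|² χ dμ > 0` at `α`, and it remains to normalize.
lemma exists_fourier_eq_one {α : K →ᵇ ℂ} (hα : α ∈ Dual K) :
    ∃ g : Lp ℂ 1 μ, fourier μ g α = 1 := by
  have h1 : α one = 1 := by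
    obtain ⟨x, hx⟩ : ∃ x, α x ≠ 0 := by
      by_contra! h
      exact hα.1 (BoundedContinuousFunction.ext h)
    have := hα.2.1 one x
    rw [one_conv, integral_dirac] at this
    exact (mul_eq_right₀ hx).1 this.symm
  obtain ⟨χ, hχ, hχ0, hχ1, -⟩ := exists_bump (isCompact_singleton (x := (one : K)))
    isOpen_univ (Set.subset_univ _)
  have hc : HasCompactSupport (α * χ) := HasCompactSupport.mul_left hχ
  have hfc : HasCompactSupport (star α * (α * χ)) := HasCompactSupport.mul_left hc
  have hf0 : ∀ t, (star α * (α * χ)) t = (‖(star α * (α * χ)) t‖ : ℂ) := fun t => by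
    have : (star α * (α * χ)) t = ((‖α t‖ ^ 2 * ‖χ t‖ : ℝ) : ℂ) := by
      push_cast
      rw [← hχ0, ← Complex.conj_mul', mul_assoc]
      rfl
    rw [this, Complex.norm_real, Real.norm_of_nonneg (by positivity)]
  have hpos := integral_norm_pos μ hfc hf0 (by simp [h1, hχ1])
  set c := ∫ t, ‖(star α * (α * χ)) t‖ ∂μ with hcdef
  have hi : Integrable (fun t => ((c⁻¹ : ℝ) : ℂ) * (α * χ) t) μ :=
    (integrable_of_cc μ hc).const_mul _
  refine ⟨hi.toL1 _, ?_⟩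
  calc fourier μ (hi.toL1 _) α = ∫ t, ((c⁻¹ : ℝ) : ℂ) * (star α * (α * χ)) t ∂μ := by
        refine integral_congr_ae ?_
        filter_upwards [hi.coeFn_toL1] with t ht
        rw [ht, mul_left_comm]
        rfl
    _ = 1 := by
        rw [integral_const_mul, integral_eq_of_nonneg hf0, ← hcdef, ← Complex.ofReal_mul,
          inv_mul_cancel₀ hpos.ne', Complex.ofReal_one]

end means

end

end Hypergroup

theorem mainTheorem2 {K : Type*} [TopologicalSpace K] [T2Space K] [LocallyCompactSpace K]
    [MeasurableSpace K] [BorelSpace K] [CommHypergroup K] (μ : Measure K) [Hypergroup.IsHaar μ]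
    (α : K →ᵇ ℂ) (hα : α ∈ Hypergroup.Dual K) :
    (Hypergroup.UCAmenable hα ↔ Hypergroup.Amenable μ α) ∧
    (∃ g : Lp ℂ 1 μ, Hypergroup.fourier μ g α = 1) ∧
    ∀ (m : Hypergroup.UC K →L[ℂ] ℂ), Hypergroup.IsAlphaMeanUC hα m →
      ∀ g : Lp ℂ 1 μ, Hypergroup.fourier μ g α = 1 →
        ∃ M : Lp ℂ ∞ μ →L[ℂ] ℂ, Hypergroup.IsAlphaMeanLinfty μ α M ∧
          (∀ φ : Lp ℂ ∞ μ, ∃ h : Hypergroup.UC K,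
            (∀ x, h.1 x = Hypergroup.convolution μ φ g x) ∧ M φ = m h) ∧
          ∀ f : Hypergroup.UC K, M (Hypergroup.toLinfty μ f.1) = m f := by
  obtain ⟨g₀, hg₀⟩ := Hypergroup.exists_fourier_eq_one μ hα
  refine ⟨⟨?_, ?_⟩, ⟨g₀, hg₀⟩, fun m hm g hg => ⟨m ∘L Hypergroup.convUC g,
    Hypergroup.isAlphaMeanLinfty_convUC hα hm hg, fun φ => ⟨Hypergroup.convUC g φ, fun x => ?_, rfl⟩,
    fun f => ?_⟩⟩
  · rintro ⟨m, hm⟩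
    exact ⟨_, Hypergroup.isAlphaMeanLinfty_convUC hα hm hg₀⟩
  · rintro ⟨M, hM⟩
    -- The restriction of `M` along `UC(K) → C^b(K) → L^∞(K)`.
    refine ⟨M ∘L Hypergroup.toLinftyL μ ∘L (Hypergroup.UC K).subtypeL, hM.map_char, fun x f => ?_⟩
    have h := Hypergroup.toLinfty_translate μ x f.1
    exact (congrArg M h).trans (hM.map_translate x _)
  · exact (Hypergroup.convolution_eq_convFun μ φ g x).symm
  · exact (Hypergroup.mean_convUC hα hm f g).trans (by rw [hg, one_mul])
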